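/- Let $n\ge 2$, $N\ge 1$, $0\le p\le n-1$ be integers and $\lambda\in\mathbb C$. Let $\Omega^p(\mathbb R^k)$ denote the smooth complex-valued $p$-forms on $\mathbb R^k$, let $\iota:\mathbb R^{n-1}\to\mathbb R^n$, $\iota(x)=(x,0)$, let $d,\delta$ be the differential and the co-differential (of the Euclidean metric) on forms on $\mathbb R^{n-1}$, $\bar d,\bar\delta$ those on forms on $\mathbb R^n$, $\Delta=d\delta+\delta d$ (with $\delta=0$ on functions), $i_{\partial_n}$ the insertion of the normal field $\partial_n$ and $\partial_n$ also the coefficientwise normal derivative of forms on $\mathbb R^n$. Define $$D_{2N}^{(p\to p)}(\lambda)=\sum_{i=1}^{N-1}(\lambda+p-2i)\,\alpha_i^{(N)}(\lambda)(d\delta)^{N-i}\iota^*(\bar\delta\bar d)^i+(\lambda+p)\sum_{i=0}^{N}\alpha_i^{(N)}(\lambda)(d\delta)^{N-i}\iota^*(\bar d\bar\delta)^i+(\lambda+p-2N)\sum_{i=0}^{N}\alpha_i^{(N)}(\lambda)(\delta d)^{N-i}\iota^*(\bar\delta\bar d)^i,$$ $$\alpha_i^{(N)}(\lambda)=(-1)^i2^N\frac{N!}{(2N)!}\binom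 Ni\prod_{k=i+1}^N(2\lambda+n-2k)\prod_{k=1}^i(2\lambda+n-2k-2N+1).$$ For $0\le j\le N$ put $$a_j^{(N)}(\lambda)=(-2)^{N-j}\frac{N!}{j!(2N-2j)!}\prod_{k=j}^{N-1}(2\lambda-4N+2k+n+1),\qquad b_j^{(N)}(\lambda)=(-2)^{N-j}\frac{N!}{j!(2N-2j+1)!}\prod_{k=j}^{N-1}(2\lambda-4N+2k+n-1),$$ and $p_j^{(N)}(\lambda;p)=(\lambda+p-2N)a_j^{(N)}(\lambda)$, $q_j^{(N-1)}(\lambda)=-2N(2\lambda+n-2N+1)b_j^{(N-1)}(\lambda)$, $r_j^{(N-1)}(\lambda)=2N\,a_j^{(N-1)}(\lambda)$. Let $\mathfrak{so}(n+1,1,\mathbb R)$ be the Lie algebra of the quadratic form $2x_0x_{n+1}+x_1^2+\dots+x_n^2$, let $\mathfrak{so}(n,1,\mathbb R)$ be the analogous Lie algebra for $\mathbb R^{n-1}$, embedded into it by inserting a zero row and a zero column at the index $n$, and let the group act locally on $\mathbb R^n$ by conformal maps by identifying $x\in\mathbb R^n$ with the line spanned by $(1,x,-|x|^2/2)$. For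 a (local) conformal diffeomorphism $\gamma$ put $\pi_\mu^{(p)}(\gamma)=e^{\mu\Phi_\gamma}\gamma_*$, where $\gamma_*=(\gamma^{-1})^*$ and $\gamma_*(g_0)=e^{2\Phi_\gamma}g_0$ for the Euclidean metric $g_0$, and let $(d\pi_\mu^{(p)}(X)\omega)(x)=\frac{d}{dt}\big|_{t=0}(\pi_\mu^{(p)}(\exp tX)\omega)(x)$; write $\pi_\mu'^{(p)}$ for the analogous representations on $\mathbb R^{n-1}$. Then $D_{2N}^{(p\to p)}(\lambda)$ maps $\Omega^p(\mathbb R^n)$ to $\Omega^p(\mathbb R^{n-1})$, and on $\Omega^p(\mathbb R^n)$ $$D_{2N}^{(p\to p)}(\lambda)=\sum_{j=0}^N(-1)^{N-j}p_j^{(N)}(\lambda;p)\,\Delta^j\iota^*\partial_n^{2N-2j}+\sum_{j=0}^{N-1}(-1)^{N-j}q_j^{(N-1)}(\lambda-1)\,\Delta^jd\,\iota^*i_{\partial_n}\partial_n^{2N-2j-1}+\sum_{j=0}^{N-1}(-1)^{N-j-1}r_j^{(N-1)}(\lambda-1)\,\Delta^jd\delta\,\iota^*\partial_n^{2N-2j-2}.$$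 Moreover, for all $X\in\mathfrak{so}(n,1,\mathbb R)$ and all $\omega\in\Omega^p(\mathbb R^n)$, the forms $d\pi_{-\lambda-p}^{(p)}(X)\omega$ and $d\pi_{-\lambda+2N-p}'^{(p)}(X)D_{2N}^{(p\to p)}(\lambda)\omega$ are well defined and smooth, and $$d\pi_{-\lambda+2N-p}'^{(p)}(X)\,D_{2N}^{(p\to p)}(\lambda)\omega=D_{2N}^{(p\to p)}(\lambda)\,d\pi_{-\lambda-p}^{(p)}(X)\omega.$$ -/

import Mathlib

open scoped ContDiff Matrix

noncomputable section

namespace SymBreak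

/-! ### Differential forms on Euclidean space and the operators `d`, `δ`, `ι^*`, `i_{∂_n}`, `∂_n` -/

/-- Euclidean space `ℝⁿ`. -/
abbrev Euc (n : ℕ) : Type := EuclideanSpace ℝ (Fin n)

/-- Complex-valued differential `p`-forms on `ℝⁿ`; the elements of `Ω^p(ℝⁿ)` are the
smooth ones, `ContDiff ℝ ∞ η`. -/
abbrev Form (n p : ℕ) : Type := Euc n → Euc n [⋀^Fin p]→L[ℝ] ℂ

/-- The standard basis vector `e_i` of `ℝⁿ`. -/
abbrev basisVec {n : ℕ} (i : Fin n) : Euc n := EuclideanSpace.single i 1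

/-- The exterior derivative `d`. -/
def extD {n p : ℕ} (η : Form n p) : Form n (p + 1) := extDeriv η

/-- The co-differential `δ` of the Euclidean metric on forms of positive degree:
`(δη)(X₁, …, X_p) = -∑ i, (∂_i η)(e_i, X₁, …, X_p)`. -/
def codiff {n p : ℕ} (η : Form n (p + 1)) : Form n p :=
  fun x => -∑ i : Fin n, (fderiv ℝ η x (basisVec i)).curryLeft (basisVec i)

/-- The composition `d δ` on `p`-forms; it vanishes on functions, where `δ = 0`. -/
def extCodiff {n : ℕ} : (p : ℕ) → Form n p → Form n p
  | 0, _ => 0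
  | _ + 1, η => extD (codiff η)

/-- The composition `δ d` on `p`-forms. -/
def codiffExt {n : ℕ} (p : ℕ) (η : Form n p) : Form n p := codiff (extD η)

/-- The (non-negative) Laplacian `Δ = δ d + d δ` on `p`-forms. -/
def laplacian {n : ℕ} (p : ℕ) (η : Form n p) : Form n p := codiffExt p η + extCodiff p η

/-- The embedding `ι : ℝᵐ → ℝᵐ⁺¹`, `(x₁, …, x_m) ↦ (x₁, …, x_m, 0)`. -/
def incl (m : ℕ) : Euc m →L[ℝ] Euc (m + 1) :=
  LinearMap.toContinuousLinearMap
    { toFun := fun x => WithLp.toLp 2 (Fin.snoc (α := fun _ => ℝ) (fun i => x i) 0)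
      map_add' := by
        intro x y
        ext i
        refine Fin.lastCases ?_ (fun j => ?_) i <;> simp
      map_smul' := by
        intro c x
        ext i
        refine Fin.lastCases ?_ (fun j => ?_) i <;> simp }

/-- The pull-back `ι^* : Ω^p(ℝᵐ⁺¹) → Ω^p(ℝᵐ)`. -/
def restr {m p : ℕ} (η : Form (m + 1) p) : Form m p :=
  fun x => (η (incl m x)).compContinuousLinearMap (incl m)

/-- The normal derivative `∂_n`, acting on the coefficients of a form; the last coordinate of
`ℝᵐ⁺¹` is the normal one. -/
def normalDeriv {m p : ℕ} (η : Form (m + 1) p) : Form (m + 1) p :=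
  fun x => fderiv ℝ η x (basisVec (Fin.last m))

/-- The insertion `i_{∂_n}` of the normal vector field into the first argument of a form. -/
def normalIns {m p : ℕ} (η : Form (m + 1) (p + 1)) : Form (m + 1) p :=
  fun x => (η x).curryLeft (basisVec (Fin.last m))

/-- The composition `d ι^* i_{∂_n} : Ω^p(ℝᵐ⁺¹) → Ω^p(ℝᵐ)`; it vanishes on functions. -/
def extRestrIns {m : ℕ} : (p : ℕ) → Form (m + 1) p → Form m p
  | 0, _ => 0
  | _ + 1, η => extD (restr (normalIns η))

/-! ### Coefficients.  Here `n` is the dimension of the ambient space. -/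

/-- `α_i^{(N)}(λ)`. -/
def alphaCoeff (n N i : ℕ) (lam : ℂ) : ℂ :=
  (-1) ^ i * 2 ^ N * ((N.factorial : ℂ) / ((2 * N).factorial : ℂ)) * (N.choose i : ℂ)
    * (∏ k ∈ Finset.Icc (i + 1) N, (2 * lam + n - 2 * k))
    * ∏ k ∈ Finset.Icc 1 i, (2 * lam + n - 2 * k - 2 * N + 1)

/-- The even Gegenbauer coefficients `a_j^{(N)}(λ)`, `0 ≤ j ≤ N`, with `a_N^{(N)}(λ) = 1`. -/
def evenGegenbauer (n N j : ℕ) (lam : ℂ) : ℂ :=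
  (-2) ^ (N - j) * ((N.factorial : ℂ) / ((j.factorial : ℂ) * ((2 * (N - j)).factorial : ℂ)))
    * ∏ k ∈ Finset.Ico j N, (2 * lam - 4 * N + 2 * k + n + 1)

/-- The odd Gegenbauer coefficients `b_j^{(N)}(λ)`, `0 ≤ j ≤ N`, with `b_N^{(N)}(λ) = 1`. -/
def oddGegenbauer (n N j : ℕ) (lam : ℂ) : ℂ :=
  (-2) ^ (N - j) * ((N.factorial : ℂ) / ((j.factorial : ℂ) * ((2 * (N - j) + 1).factorial : ℂ)))
    * ∏ k ∈ Finset.Ico j N, (2 * lam - 4 * N + 2 * k + n - 1)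

/-- `p_j^{(N)}(λ; p)`. -/
def pCoeff (n N j p : ℕ) (lam : ℂ) : ℂ := (lam + p - 2 * N) * evenGegenbauer n N j lam

/-- `q_j^{(N-1)}(λ)`, for `N ≥ 1`. -/
def qCoeff (n N j : ℕ) (lam : ℂ) : ℂ :=
  -2 * N * (2 * lam + n - 2 * N + 1) * oddGegenbauer n (N - 1) j lam

/-- `r_j^{(N-1)}(λ)`, for `N ≥ 1`. -/
def rCoeff (n N j : ℕ) (lam : ℂ) : ℂ := 2 * N * evenGegenbauer n (N - 1) j lam

/-! ### The two formulas for the operator `Ω^p(ℝⁿ) → Ω^p(ℝⁿ⁻¹)`, with `n = m + 1` -/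

/-- The geometric formula, in terms of `d`, `δ` on `ℝᵐ`, their counterparts on `ℝᵐ⁺¹`,
and `ι^*`. -/
def evenOp (m N p : ℕ) (lam : ℂ) (η : Form (m + 1) p) : Form m p :=
  ∑ i ∈ Finset.Icc 1 (N - 1), ((lam + p - 2 * i) * alphaCoeff (m + 1) N i lam) •
      (extCodiff p)^[N - i] (restr ((codiffExt p)^[i] η))
  + (lam + p) • ∑ i ∈ Finset.range (N + 1), alphaCoeff (m + 1) N i lam •
      (extCodiff p)^[N - i] (restr ((extCodiff p)^[i] η))
  + (lam + p - 2 * N) • ∑ i ∈ Finset.range (N + 1), alphaCoeff (m + 1) N i lam •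
      (codiffExt p)^[N - i] (restr ((codiffExt p)^[i] η))

/-- The formula with Gegenbauer coefficients, in terms of `Δ`, `d`, `δ` on `ℝᵐ`, and `ι^*`,
`∂_n`, `i_{∂_n}`. -/
def evenOpGegenbauer (m N p : ℕ) (lam : ℂ) (η : Form (m + 1) p) : Form m p :=
  ∑ j ∈ Finset.range (N + 1), ((-1) ^ (N - j) * pCoeff (m + 1) N j p lam) •
      (laplacian p)^[j] (restr (normalDeriv^[2 * N - 2 * j] η))
  + ∑ j ∈ Finset.range N, ((-1) ^ (N - j) * qCoeff (m + 1) N j (lam - 1)) •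
      (laplacian p)^[j] (extRestrIns p (normalDeriv^[2 * N - 2 * j - 1] η))
  + ∑ j ∈ Finset.range N, ((-1) ^ (N - j - 1) * rCoeff (m + 1) N j (lam - 1)) •
      (laplacian p)^[j] (extCodiff p (restr (normalDeriv^[2 * N - 2 * j - 2] η)))

/-! ### The conformal Lie algebras -/

/-- The index set `{0} ∪ {1, …, n} ∪ {n + 1}` of the coordinates of `ℝⁿ⁺²`. -/
abbrev CIdx (n : ℕ) : Type := Unit ⊕ Fin n ⊕ Unit

/-- The Gram matrix of the quadratic form `2 x₀ x_{n+1} + x₁² + ⋯ + x_n²`. -/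
def gram (n : ℕ) : Matrix (CIdx n) (CIdx n) ℝ
  | .inl _, .inr (.inr _) => 1
  | .inr (.inr _), .inl _ => 1
  | .inr (.inl i), .inr (.inl j) => if i = j then 1 else 0
  | _, _ => 0

/-- The Lie algebra `𝔰𝔬(n+1, 1, ℝ)` of the quadratic form `2 x₀ x_{n+1} + x₁² + ⋯ + x_n²`: the
matrices `X` with `Xᵀ J = -J X`, where `J` is the Gram matrix. -/
abbrev soConf (n : ℕ) : Submodule ℝ (Matrix (CIdx n) (CIdx n) ℝ) :=
  skewAdjointMatricesSubmodule (gram n)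

/-- The partial inverse of the inclusion of indices `CIdx m → CIdx (m + 1)` that misses the
index of the normal coordinate. -/
def idxPart (m : ℕ) : CIdx (m + 1) → Option (CIdx m)
  | .inl u => some (.inl u)
  | .inr (.inr u) => some (.inr (.inr u))
  | .inr (.inl i) => Fin.lastCases none (fun j => some (.inr (.inl j))) i

/-- The block inclusion of matrices with a zero row and a zero column at the index of the
normal coordinate. -/
def blockIncl {m : ℕ} (X : Matrix (CIdx m) (CIdx m) ℝ) :
    Matrix (CIdx (m + 1)) (CIdx (m + 1)) ℝ :=
  fun a b => match idxPart m a, idxPart m b with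
    | some a', some b' => X a' b'
    | _, _ => 0

theorem blockIncl_mem {m : ℕ} (X : soConf m) : blockIncl (X : Matrix _ _ ℝ) ∈ soConf (m + 1) := by
  have hX : (X : Matrix (CIdx m) (CIdx m) ℝ)ᵀ * gram m = gram m * -X :=
    (mem_skewAdjointMatricesSubmodule _ _).1 X.2
  have key : ∀ a b, ((X : Matrix (CIdx m) (CIdx m) ℝ)ᵀ * gram m) a b = (gram m * -X) a b :=
    fun a b => by rw [hX]
  refine (mem_skewAdjointMatricesSubmodule _ _).2 ?_
  change (blockIncl (X : Matrix (CIdx m) (CIdx m) ℝ))ᵀ * gram (m + 1) = gram (m + 1) * -blockIncl X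
  have hl : ∀ x : Fin m, Fin.last m ≠ x.castSucc := fun x => (Fin.castSucc_lt_last x).ne'
  simp only [Matrix.mul_apply, Fintype.sum_sum_type, Matrix.transpose_apply,
    Matrix.neg_apply] at key
  ext a b
  rcases a with a | a | a <;> rcases b with b | b | b <;>
    simp only [Matrix.mul_apply, Fintype.sum_sum_type, Matrix.transpose_apply,
      Matrix.neg_apply, Fin.sum_univ_castSucc]
  all_goals try (refine Fin.lastCases ?_ (fun a => ?_) a)
  all_goals try (refine Fin.lastCases ?_ (fun b => ?_) b)
  all_goals simp [blockIncl, idxPart, gram, hl]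
  · simpa [gram] using key (.inl a) (.inl b)
  · simpa [gram] using key (.inl a) (.inr (.inl b))
  · simpa [gram] using key (.inl a) (.inr (.inr b))
  · simpa [gram] using key (.inr (.inl a)) (.inl b)
  · simpa [gram] using key (.inr (.inl a)) (.inr (.inl b))
  · simpa [gram] using key (.inr (.inl a)) (.inr (.inr b))
  · simpa [gram] using key (.inr (.inr a)) (.inl b)
  · simpa [gram] using key (.inr (.inr a)) (.inr (.inl b))
  · simpa [gram] using key (.inr (.inr a)) (.inr (.inr b))

/-- The inclusion `𝔰𝔬(n, 1, ℝ) → 𝔰𝔬(n+1, 1, ℝ)`, where `n = m + 1`. -/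
def soIncl {m : ℕ} (X : soConf m) : soConf (m + 1) := ⟨blockIncl X, blockIncl_mem X⟩

/-! ### The local conformal action on `ℝⁿ` and the representations `π_λ^{(p)}` -/

/-- The representative `(1, x, -|x|²/2)` of the isotropic line that corresponds to `x ∈ ℝⁿ`. -/
def lift {n : ℕ} (x : Euc n) : CIdx n → ℝ
  | .inl _ => 1
  | .inr (.inl i) => x i
  | .inr (.inr _) => -(‖x‖ ^ 2 / 2)

/-- The action on `ℝⁿ` of a matrix `g` preserving the quadratic form: the line of `lift x` is sent
to the line of `lift (act g x)`.  It is a conformal map defined where the component with index `0`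
of `g (lift x)` does not vanish. -/
def act {n : ℕ} (g : Matrix (CIdx n) (CIdx n) ℝ) (x : Euc n) : Euc n :=
  WithLp.toLp 2 fun i => (g *ᵥ lift x) (.inr (.inl i)) / (g *ᵥ lift x) (.inl ())

/-- For a conformal map `γ` with inverse `γinv`, the value at `x` of the function `Φ_γ` with
`γ_* g₀ = (γinv)^* g₀ = e^{2 Φ_γ} g₀`: the differential of `γinv` at `x` is `e^{Φ_γ(x)}` times an
isometry. -/
def confExp {n : ℕ} (γinv : Euc n → Euc n) (x : Euc n) : ℝ := Real.log ‖fderiv ℝ γinv x‖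

/-- The form `π_λ^{(p)}(γ) η = e^{λ Φ_γ} γ_* η`, where `γ_* = (γinv)^*` and `γinv` is the inverse
of the conformal map `γ`. -/
def confRep {n p : ℕ} (lam : ℂ) (γinv : Euc n → Euc n) (η : Form n p) : Form n p :=
  fun x => Complex.exp (lam * (confExp γinv x : ℂ)) •
    (η (γinv x)).compContinuousLinearMap (fderiv ℝ γinv x)

/-- The curve `t ↦ π_λ^{(p)}(exp(tX)) η`; its value at a given point is meaningful for small `t`. -/
def repCurve {n p : ℕ} (lam : ℂ) (X : soConf n) (η : Form n p) (t : ℝ) : Form n p :=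
  confRep lam (act ((NormedSpace.exp (t • (X : Matrix (CIdx n) (CIdx n) ℝ)))⁻¹)) η

/-- The infinitesimal representation `dπ_λ^{(p)}(X) η = d/dt|₀ π_λ^{(p)}(exp(tX)) η`. -/
def dRep {n p : ℕ} (lam : ℂ) (X : soConf n) (η : Form n p) : Form n p :=
  fun x => deriv (fun t : ℝ => repCurve lam X η t x) 0

/-- The derivative that defines `dπ_λ^{(p)}(X) η` exists at every point, and `dπ_λ^{(p)}(X) η` is
a smooth form. -/
def HasDRep {n p : ℕ} (lam : ℂ) (X : soConf n) (η : Form n p) : Prop :=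
  (∀ x, DifferentiableAt ℝ (fun t : ℝ => repCurve lam X η t x) 0) ∧ ContDiff ℝ ∞ (dRep lam X η)

end SymBreak

end

noncomputable section

namespace SymBreak

/-! ### The commutation relations between `d`, `δ` and an infinitesimal conformal action -/

/-! The proof is algebraic: it uses only commutation relations on smooth forms of mixed degree.

An element of the Lie algebra generates a conformal vector field `V` with conformal factor `σ`,
whose gradient `b` is constant. On `p`-forms the infinitesimal representation with parameter `-l -
p` is `ρ l = L_V - σ (l + deg)`. Writing the weight as `l + deg` makes `d` and `δ` both lower `l` by
one, up to errors given by the exterior product with and the insertion of `b`. Hence `Δ` lowers `l`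
by two, with an error made of `∂_b`, `i_b d` and `b ∧ δ`. All these errors commute with `Δ`, so
powers of `Δ` are handled by induction (`lap_pow_ρ`). `ConfCalc` records these relations, and
`RestrCalc` adds a restriction that commutes with `d` and with the data of a tangential field.

With `d² = δ² = 0` and `ι^* d = d ι^*`, the geometric operator becomes `sbo`, a combination of `Δ^k
ι^* Δ̄^i`, `dδ Δ^k ι^* Δ̄^i` and `d Δ^k ι^* δ̄ Δ̄^i` (`geomOp_eq_sbo`). The errors from commuting
`sbo` with `ρ` cancel as soon as consecutive `α_i` satisfy one two-term recursion (`sbo_ρ`), and the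
given coefficients do (`alphaCoeff_succ`).

For the Gegenbauer formula, `ι^* Δ̄ = Δ ι^* - ι^* ∂_n²`, and the two operations on the right
commute. The binomial theorem thus expands `ι^* Δ̄^i` (`pow_expand`, `sbo_eq_normal`). The resulting
sums of `α_i` against binomial coefficients are evaluated by the Chu–Vandermonde identity
(`sum_alphaCoeff_mul_choose`).

It remains to verify the relations for actual forms. The essential one is `δ_extF`, a dual Cartan
formula for conformal fields, which controls `δ L_V`. Finally `hasDerivAt_confRep` identifies the
derivative of the group action with `ρ`. -/

/-- Operators on a space of differential forms in dimension `n`: the differential `d`, the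
co-differential `δ`, the exterior product `e` with, the insertion `i` of and the derivative `D` in
the direction of a constant vector, the degree `P`, and a family `ρ` of operators that represent
an infinitesimal conformal map whose conformal factor has the given vector as its gradient. -/
structure ConfCalc (n : ℂ) (U : Type*) [AddCommGroup U] [Module ℂ U] where
  d : U →ₗ[ℂ] U
  δ : U →ₗ[ℂ] U
  e : U →ₗ[ℂ] U
  i : U →ₗ[ℂ] U
  D : U →ₗ[ℂ] U
  P : U →ₗ[ℂ] U
  ρ : ℂ → U →ₗ[ℂ] U
  d_d : ∀ u, d (d u) = 0
  δ_δ : ∀ u, δ (δ u) = 0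
  d_i : ∀ u, d (i u) = D u - i (d u)
  δ_e : ∀ u, δ (e u) = -D u - e (δ u)
  δ_i : ∀ u, δ (i u) = -i (δ u)
  d_e : ∀ u, d (e u) = -e (d u)
  d_D : ∀ u, d (D u) = D (d u)
  δ_D : ∀ u, δ (D u) = D (δ u)
  P_d : ∀ u, P (d u) = d (P u) + d u
  P_δ : ∀ u, P (δ u) = δ (P u) - δ u
  d_ρ : ∀ l u, d (ρ l u) = ρ (l - 1) (d u) - e (l • u + P u)
  δ_ρ : ∀ l u, δ (ρ l u) = ρ (l - 1) (δ u) + i ((n + l) • u - P u)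

namespace ConfCalc

variable {n : ℂ} {U : Type*} [AddCommGroup U] [Module ℂ U] (c : ConfCalc n U)

/-- The Laplacian. -/
def lap : Module.End ℂ U := c.δ ∘ₗ c.d + c.d ∘ₗ c.δ

lemma lap_apply (u : U) : c.lap u = c.δ (c.d u) + c.d (c.δ u) := rfl

lemma δ_d (u : U) : c.δ (c.d u) = c.lap u - c.d (c.δ u) := by
  rw [lap_apply]; module

lemma lap_d (u : U) : c.lap (c.d u) = c.d (c.lap u) := by
  simp [lap_apply, c.d_d]

lemma lap_δ (u : U) : c.lap (c.δ u) = c.δ (c.lap u) := by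
  simp [lap_apply, c.δ_δ]

lemma lap_D (u : U) : c.lap (c.D u) = c.D (c.lap u) := by
  simp [lap_apply, c.d_D, c.δ_D]

lemma lap_e (u : U) : c.lap (c.e u) = c.e (c.lap u) := by
  simp only [lap_apply, c.d_e, c.δ_e, map_neg, map_sub, map_add, c.d_D]
  module

lemma lap_i (u : U) : c.lap (c.i u) = c.i (c.lap u) := by
  simp only [lap_apply, c.d_i, c.δ_i, map_neg, map_sub, map_add, c.δ_D]
  module

lemma P_lap (u : U) : c.P (c.lap u) = c.lap (c.P u) := by
  simp only [lap_apply, c.P_d, c.P_δ, map_sub, map_add]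
  module

lemma pow_comm {f : U →ₗ[ℂ] U} (h : ∀ u, c.lap (f u) = f (c.lap u)) (k : ℕ) (u : U) :
    (c.lap ^ k) (f u) = f ((c.lap ^ k) u) := by
  induction k generalizing u with
  | zero => simp
  | succ k ih => simp only [pow_succ, Module.End.mul_apply, h, ih]

/-- The errors from `d` and from `δ` each contain a multiple of `D` depending on the degree, namely
`l + P` and `n + l - P`. The degree cancels in the sum, so the coefficient is the scalar `n + 2 *
l`. -/
lemma lap_ρ (l : ℂ) (u : U) : c.lap (c.ρ l u) = c.ρ (l - 2) (c.lap u)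
    + ((n + 2 * l) • c.D u - (2 : ℂ) • c.i (c.d u) + (2 : ℂ) • c.e (c.δ u)) := by
  simp only [lap_apply, c.d_ρ, c.δ_ρ, map_sub, map_add, map_smul, c.d_i, c.δ_e, c.P_d,
    c.P_δ, show l - 1 - 1 = l - 2 by ring]
  module

/-- The correction term in the commutation of `ρ` with a power of the Laplacian. -/
def corr (k : ℂ) (u : U) : U := k • c.D u - (2 : ℂ) • c.i (c.d u) + (2 : ℂ) • c.e (c.δ u)

/-- The correction commutes with `lap`, so iterating `lap_ρ` only adds up its coefficients: the sum
of `n + 2l - 4s` over `0 ≤ s ≤ k` is `(k + 1)(n + 2l - 2k)`. -/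
lemma lap_pow_ρ (k : ℕ) (l : ℂ) (u : U) : (c.lap ^ (k + 1)) (c.ρ l u) =
    c.ρ (l - 2 * (k + 1)) ((c.lap ^ (k + 1)) u)
      + ((k : ℂ) + 1) • c.corr (n + 2 * l - 2 * k) ((c.lap ^ k) u) := by
  induction k with
  | zero => simp [lap_ρ, corr]
  | succ k ih =>
    rw [pow_succ', Module.End.mul_apply, ih, map_add, map_smul, lap_ρ]
    simp only [corr, map_add, map_sub, map_smul, lap_D, lap_i, lap_e, lap_d, lap_δ,
      pow_succ', Module.End.mul_apply, Nat.cast_succ,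
      show l - 2 * (k + 1) - 2 = l - 2 * (k + 1 + 1) by ring]
    module

end ConfCalc

/-! ### Commutation of the restricted powers of the Laplacian with the conformal action -/

/-- Operators on the forms on a hyperplane and on its ambient space, with the restriction `r`. -/
structure RestrCalc (n : ℂ) (U W : Type*) [AddCommGroup U] [Module ℂ U] [AddCommGroup W]
    [Module ℂ W] where
  amb : ConfCalc n U
  hyp : ConfCalc (n - 1) W
  r : U →ₗ[ℂ] W
  r_d : ∀ u, r (amb.d u) = hyp.d (r u)
  r_e : ∀ u, r (amb.e u) = hyp.e (r u)
  r_i : ∀ u, r (amb.i u) = hyp.i (r u)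
  r_D : ∀ u, r (amb.D u) = hyp.D (r u)
  r_ρ : ∀ l u, r (amb.ρ l u) = hyp.ρ l (r u)

namespace RestrCalc

variable {n : ℂ} {U W : Type*} [AddCommGroup U] [Module ℂ U] [AddCommGroup W] [Module ℂ W]
  (c : RestrCalc n U W)

/-- `ι^* Δ̄ⁱ`. -/
def g (i : ℕ) : U →ₗ[ℂ] W := c.r ∘ₗ (c.amb.lap ^ i)

/-- `ι^* δ̄ Δ̄ⁱ`. -/
def h (i : ℕ) : U →ₗ[ℂ] W := c.r ∘ₗ c.amb.δ ∘ₗ (c.amb.lap ^ i)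

/-- `Δᵏ ι^* Δ̄ⁱ`. -/
def x (k i : ℕ) (u : U) : W := (c.hyp.lap ^ k) (c.g i u)

/-- `Δᵏ ι^* δ̄ Δ̄ⁱ`. -/
def y (k i : ℕ) (u : U) : W := (c.hyp.lap ^ k) (c.h i u)

lemma g_ρ (i : ℕ) (l : ℂ) (u : U) : c.g (i + 1) (c.amb.ρ l u) =
    c.hyp.ρ (l - 2 * (i + 1)) (c.g (i + 1) u) + ((i : ℂ) + 1) •
      ((n + 2 * l - 2 * i) • c.hyp.D (c.g i u) - (2 : ℂ) • c.hyp.i (c.hyp.d (c.g i u))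
        + (2 : ℂ) • c.hyp.e (c.h i u)) := by
  simp [g, h, ConfCalc.lap_pow_ρ, ConfCalc.corr, c.r_D, c.r_i, c.r_d, c.r_e, c.r_ρ]

/-- The coefficient `n + l - p` does not depend on `i`: the lowered weight contributes `-2 (i + 1)`,
while replacing `δ d` by `Δ - d δ` in the correction contributes `2 (i + 1)`. -/
lemma h_ρ (i : ℕ) (l p : ℂ) (u : U) (hu : c.amb.P u = p • u) : c.h (i + 1) (c.amb.ρ l u) =
    c.hyp.ρ (l - 2 * (i + 1) - 1) (c.h (i + 1) u)
      + (n + l - p) • c.hyp.i (c.g (i + 1) u)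
      + ((i : ℂ) + 1) • ((n + 2 * l - 2 * i - 2) • c.hyp.D (c.h i u)
        - (2 : ℂ) • c.hyp.i (c.hyp.d (c.h i u))) := by
  have hP : c.amb.P ((c.amb.lap ^ (i + 1)) u) = p • (c.amb.lap ^ (i + 1)) u := by
    rw [← c.amb.pow_comm (fun u => (c.amb.P_lap u).symm), hu, map_smul]
  have hs : (c.amb.lap ^ (i + 1)) u = c.amb.lap ((c.amb.lap ^ i) u) := by
    rw [pow_succ']; rfl
  simp only [g, h, ConfCalc.lap_pow_ρ, ConfCalc.corr, LinearMap.comp_apply, map_add, map_sub,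
    map_smul, c.amb.δ_D, c.amb.δ_i, c.amb.δ_e, c.amb.δ_ρ, hP, map_neg, c.amb.δ_δ, map_zero,
    c.amb.δ_d, ← hs, c.r_D, c.r_i, c.r_d,
    c.r_ρ]
  module

lemma g_zero_ρ (l : ℂ) (u : U) : c.g 0 (c.amb.ρ l u) = c.hyp.ρ l (c.g 0 u) := by
  simp [g, c.r_ρ]

lemma h_zero_ρ (l p : ℂ) (u : U) (hu : c.amb.P u = p • u) : c.h 0 (c.amb.ρ l u) =
    c.hyp.ρ (l - 1) (c.h 0 u) + (n + l - p) • c.hyp.i (c.g 0 u) := by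
  simp only [g, h, pow_zero, LinearMap.comp_apply, Module.End.one_apply, c.amb.δ_ρ, hu, map_add,
    map_sub, map_smul, c.r_i, c.r_ρ]
  module

end RestrCalc

end SymBreak

/-! ### The abstract operator and its equivariance -/

namespace SymBreak

/-- Each commutation with `ρ` removes one Laplacian, either the ambient one or the one on the
hyperplane. Reindexing puts both kinds of error on the same terms, with exponents adding up to `K -
1`. The truncated subtractions are harmless because their factors `i` and `K - i` vanish there. -/
lemma sum_shift {W : Type*} [AddCommGroup W] [Module ℂ W] (K : ℕ) (a : ℕ → ℂ) (A B : ℕ → ℕ → W) :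
    ∑ i ∈ Finset.range (K + 1), a i • ((i : ℂ) • A (K - i) (i - 1)
        + ((K - i : ℕ) : ℂ) • B (K - i - 1) i)
      = ∑ i ∈ Finset.range K, (((i + 1) * a (i + 1)) • A (K - i - 1) i
        + ((K - i : ℂ) * a i) • B (K - i - 1) i) := by
  simp only [smul_add, Finset.sum_add_distrib]
  congr 1
  · rw [Finset.sum_range_succ']
    simp only [Nat.cast_zero, zero_smul, smul_zero, add_zero, Nat.add_sub_cancel, Nat.sub_sub]
    refine Finset.sum_congr rfl fun i _ => ?_
    push_cast
    module
  · rw [Finset.sum_range_succ]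
    simp only [Nat.sub_self, Nat.cast_zero, zero_smul, smul_zero, add_zero]
    refine Finset.sum_congr rfl fun i hi => ?_
    rw [Nat.cast_sub (Finset.mem_range.1 hi).le]
    module

namespace RestrCalc

variable {n : ℂ} {U W : Type*} [AddCommGroup U] [Module ℂ U] [AddCommGroup W] [Module ℂ W]
  (c : RestrCalc n U W)

/-- The first error comes from the ambient powers, the second from the powers on the hyperplane. The
latter has dimension `n - 1` and meets the weight already lowered to `l - 2i`, whence `n + 1 + 2l -
4i - 2k`. -/
lemma x_ρ (k i : ℕ) (l : ℂ) (u : U) : c.x k i (c.amb.ρ l u) =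
    c.hyp.ρ (l - 2 * (i + k)) (c.x k i u) + ((i : ℂ) •
      ((n + 2 * l - 2 * (i - 1)) • c.hyp.D (c.x k (i - 1) u)
        - (2 : ℂ) • c.hyp.i (c.hyp.d (c.x k (i - 1) u)) + (2 : ℂ) • c.hyp.e (c.y k (i - 1) u))
      + (k : ℂ) • c.hyp.corr (n + 1 + 2 * l - 4 * i - 2 * k) (c.x (k - 1) i u)) := by
  have hg : ∃ z, c.g i (c.amb.ρ l u) = c.hyp.ρ (l - 2 * i) (c.g i u) + (i : ℂ) • z ∧
      z = (n + 2 * l - 2 * (i - 1)) • c.hyp.D (c.g (i - 1) u)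
        - (2 : ℂ) • c.hyp.i (c.hyp.d (c.g (i - 1) u)) + (2 : ℂ) • c.hyp.e (c.h (i - 1) u) := by
    refine ⟨_, ?_, rfl⟩
    rcases i with _ | i
    · simp [g_zero_ρ]
    · simp [g_ρ]
  obtain ⟨z, hz, rfl⟩ := hg
  rw [x, hz]
  have hρ : ∀ w, (c.hyp.lap ^ k) (c.hyp.ρ (l - 2 * i) w) =
      c.hyp.ρ (l - 2 * (i + k)) ((c.hyp.lap ^ k) w) +
        (k : ℂ) • c.hyp.corr (n + 1 + 2 * l - 4 * i - 2 * k) ((c.hyp.lap ^ (k - 1)) w) := by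
    intro w
    rcases k with _ | k
    · simp
    · rw [ConfCalc.lap_pow_ρ]
      push_cast
      congr 3 <;> ring
  simp only [map_add, map_sub, map_smul, hρ, c.hyp.pow_comm c.hyp.lap_D,
    c.hyp.pow_comm c.hyp.lap_i, c.hyp.pow_comm c.hyp.lap_d, c.hyp.pow_comm c.hyp.lap_e, x, y]
  module

lemma y_ρ (k i : ℕ) (l p : ℂ) (u : U) (hu : c.amb.P u = p • u) : c.y k i (c.amb.ρ l u) =
    c.hyp.ρ (l - 2 * (i + k) - 1) (c.y k i u) + (n + l - p) • c.hyp.i (c.x k i u)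
      + ((i : ℂ) • ((n + 2 * l - 2 * (i - 1) - 2) • c.hyp.D (c.y k (i - 1) u)
        - (2 : ℂ) • c.hyp.i (c.hyp.d (c.y k (i - 1) u)))
      + (k : ℂ) • c.hyp.corr (n - 1 + 2 * l - 4 * i - 2 * k) (c.y (k - 1) i u)) := by
  have hh : ∃ z, c.h i (c.amb.ρ l u) = c.hyp.ρ (l - 2 * i - 1) (c.h i u)
      + (n + l - p) • c.hyp.i (c.g i u) + (i : ℂ) • z ∧
      z = (n + 2 * l - 2 * (i - 1) - 2) • c.hyp.D (c.h (i - 1) u)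
        - (2 : ℂ) • c.hyp.i (c.hyp.d (c.h (i - 1) u)) := by
    refine ⟨_, ?_, rfl⟩
    rcases i with _ | i
    · simp [c.h_zero_ρ l p u hu]
    · simp [c.h_ρ i l p u hu]
  obtain ⟨z, hz, rfl⟩ := hh
  rw [y, hz]
  have hρ : ∀ w, (c.hyp.lap ^ k) (c.hyp.ρ (l - 2 * i - 1) w) =
      c.hyp.ρ (l - 2 * (i + k) - 1) ((c.hyp.lap ^ k) w) +
        (k : ℂ) • c.hyp.corr (n - 1 + 2 * l - 4 * i - 2 * k) ((c.hyp.lap ^ (k - 1)) w) := by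
    intro w
    rcases k with _ | k
    · simp
    · rw [ConfCalc.lap_pow_ρ]
      push_cast
      congr 3 <;> ring
  simp only [map_add, map_sub, map_smul, hρ, c.hyp.pow_comm c.hyp.lap_D,
    c.hyp.pow_comm c.hyp.lap_i, c.hyp.pow_comm c.hyp.lap_d, x, y]
  module

/-- The symmetry breaking operator with coefficients `α`, in terms of powers of Laplacians. -/
def sbo (l p : ℂ) (N : ℕ) (α : ℕ → ℂ) (u : U) : W :=
  (l + p - 2 * N) • ∑ i ∈ Finset.range (N + 1), α i • c.x (N - i) i u
  + (2 : ℂ) • ∑ i ∈ Finset.range N, (((N - i) * α i) • c.hyp.d (c.hyp.δ (c.x (N - i - 1) i u))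
      + ((i + 1) * α (i + 1)) • c.hyp.d (c.y (N - i - 1) i u))

lemma lap_x (k i : ℕ) (u : U) : c.hyp.lap (c.x k i u) = c.x (k + 1) i u := by
  rw [x, x, pow_succ']; rfl

lemma sum_x_ρ (K : ℕ) (l : ℂ) (α : ℕ → ℂ) (u : U) :
    ∑ i ∈ Finset.range (K + 1), α i • c.x (K - i) i (c.amb.ρ l u)
      = c.hyp.ρ (l - 2 * K) (∑ i ∈ Finset.range (K + 1), α i • c.x (K - i) i u)
      + ∑ i ∈ Finset.range K,
        (((i + 1) * α (i + 1)) • ((n + 2 * l - 2 * i) • c.hyp.D (c.x (K - i - 1) i u)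
          - (2 : ℂ) • c.hyp.i (c.hyp.d (c.x (K - i - 1) i u))
          + (2 : ℂ) • c.hyp.e (c.y (K - i - 1) i u)) +
        ((K - i) * α i) • c.hyp.corr (n + 1 + 2 * l - 2 * i - 2 * K) (c.x (K - i - 1) i u)) := by
  rw [← sum_shift K α
    (fun k j : ℕ => (n + 2 * l - 2 * j) • c.hyp.D (c.x k j u)
        - (2 : ℂ) • c.hyp.i (c.hyp.d (c.x k j u)) + (2 : ℂ) • c.hyp.e (c.y k j u))
    (fun k j : ℕ => c.hyp.corr (n + 1 + 2 * l - 2 * j - 2 * K) (c.x k j u)),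
    map_sum, ← Finset.sum_add_distrib]
  refine Finset.sum_congr rfl fun i hi => ?_
  have hi' : i ≤ K := by simpa [Nat.lt_succ_iff] using hi
  rw [x_ρ, smul_add, Nat.cast_sub hi', map_smul, show l - 2 * ((i : ℂ) + (K - i)) = l - 2 * K by
    ring, show n + 1 + 2 * l - 4 * (i : ℂ) - 2 * (K - i) = n + 1 + 2 * l - 2 * i - 2 * K by ring]
  rcases i with _ | i <;> simp

lemma sum_y_ρ (K : ℕ) (l p : ℂ) (β : ℕ → ℂ) (u : U) (hu : c.amb.P u = p • u) :
    ∑ i ∈ Finset.range (K + 1), β i • c.y (K - i) i (c.amb.ρ l u)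
      = c.hyp.ρ (l - 2 * K - 1) (∑ i ∈ Finset.range (K + 1), β i • c.y (K - i) i u)
      + ∑ i ∈ Finset.range (K + 1), (β i * (n + l - p)) • c.hyp.i (c.x (K - i) i u)
      + ∑ i ∈ Finset.range K,
        (((i + 1) * β (i + 1)) • ((n + 2 * l - 2 * i - 2) • c.hyp.D (c.y (K - i - 1) i u)
          - (2 : ℂ) • c.hyp.i (c.hyp.d (c.y (K - i - 1) i u))) +
        ((K - i) * β i) • c.hyp.corr (n - 1 + 2 * l - 2 * i - 2 * K) (c.y (K - i - 1) i u)) := by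
  rw [← sum_shift K β
    (fun k j : ℕ => (n + 2 * l - 2 * j - 2) • c.hyp.D (c.y k j u)
        - (2 : ℂ) • c.hyp.i (c.hyp.d (c.y k j u)))
    (fun k j : ℕ => c.hyp.corr (n - 1 + 2 * l - 2 * j - 2 * K) (c.y k j u)),
    map_sum, ← Finset.sum_add_distrib, ← Finset.sum_add_distrib]
  refine Finset.sum_congr rfl fun i hi => ?_
  have hi' : i ≤ K := by simpa [Nat.lt_succ_iff] using hi
  rw [c.y_ρ _ _ _ _ _ hu, smul_add, smul_add, Nat.cast_sub hi', map_smul, smul_smul,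
    show l - 2 * ((i : ℂ) + (K - i)) - 1 = l - 2 * K - 1 by ring,
    show n - 1 + 2 * l - 4 * (i : ℂ) - 2 * (K - i) = n - 1 + 2 * l - 2 * i - 2 * K by ring]
  rcases i with _ | i <;> simp

lemma P_g (p : ℂ) (u : U) (hP : ∀ u, c.r (c.amb.P u) = c.hyp.P (c.r u))
    (hu : c.amb.P u = p • u) (k i : ℕ) : c.hyp.P (c.x k i u) = p • c.x k i u := by
  rw [x, g, ← c.hyp.pow_comm (fun u => (c.hyp.P_lap u).symm), LinearMap.comp_apply, ← hP,
    ← c.amb.pow_comm (fun u => (c.amb.P_lap u).symm), hu]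
  simp

lemma P_h (p : ℂ) (u : U) (hP : ∀ u, c.r (c.amb.P u) = c.hyp.P (c.r u))
    (hu : c.amb.P u = p • u) (k i : ℕ) : c.hyp.P (c.y k i u) = (p - 1) • c.y k i u := by
  rw [y, h, ← c.hyp.pow_comm (fun u => (c.hyp.P_lap u).symm), LinearMap.comp_apply,
    LinearMap.comp_apply, ← hP, c.amb.P_δ, ← c.amb.pow_comm (fun u => (c.amb.P_lap u).symm), hu]
  simp [sub_smul]

/-- The operator `sbo` intertwines the infinitesimal conformal actions. -/
theorem sbo_ρ (l p : ℂ) (M : ℕ) (α : ℕ → ℂ) (u : U)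
    (hP : ∀ u, c.r (c.amb.P u) = c.hyp.P (c.r u)) (hu : c.amb.P u = p • u)
    (hα : ∀ i < M + 1, (i + 1) * α (i + 1) * (2 * l + n - 2 * i - 2)
      = -((((M + 1 : ℕ) : ℂ) - i) * α i * (2 * l + n - 2 * i - 1 - 2 * (M + 1 : ℕ)))) :
    c.sbo l p (M + 1) α (c.amb.ρ l u) = c.hyp.ρ (l - 2 * (M + 1 : ℕ)) (c.sbo l p (M + 1) α u) := by
  set N := M + 1 with hN
  set γ : ℕ → ℂ := fun i => (N - i) * α i with hγ
  set β : ℕ → ℂ := fun i => (i + 1) * α (i + 1) with hβ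
  have hsub : ∀ i, N - i - 1 = M - i := by omega
  have hform : ∀ u, c.sbo l p N α u = (l + p - 2 * N) • ∑ i ∈ Finset.range (N + 1),
      α i • c.x (N - i) i u
      + (2 : ℂ) • (c.hyp.d (c.hyp.δ (∑ i ∈ Finset.range (M + 1), γ i • c.x (M - i) i u))
        + c.hyp.d (∑ i ∈ Finset.range (M + 1), β i • c.y (M - i) i u)) := by
    intro u
    simp only [sbo, hsub, map_sum, map_smul, ← Finset.sum_add_distrib, hγ, hβ, ← hN]
  have hX : ∀ a : ℕ → ℂ, c.hyp.P (∑ i ∈ Finset.range (M + 1), a i • c.x (M - i) i u)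
      = p • ∑ i ∈ Finset.range (M + 1), a i • c.x (M - i) i u := fun a => by
    simp only [map_sum, map_smul, c.P_g p u hP hu, Finset.smul_sum, smul_comm p]
  have hY : ∀ a : ℕ → ℂ, c.hyp.P (∑ i ∈ Finset.range (M + 1), a i • c.y (M - i) i u)
      = (p - 1) • ∑ i ∈ Finset.range (M + 1), a i • c.y (M - i) i u := fun a => by
    simp only [map_sum, map_smul, c.P_h p u hP hu, Finset.smul_sum, smul_comm (p - 1)]
  have hNM : (N : ℂ) = M + 1 := by simp [hN]
  rw [hform, hform, sum_x_ρ, sum_x_ρ, c.sum_y_ρ _ _ _ _ _ hu]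
  -- By the recursion, the coefficient of `D` in the error of the leading sum is `2 (β i + γ i)`.
  -- Then `D = d i + i d` absorbs the terms in `i d`.
  have hF1 : ∑ i ∈ Finset.range N,
        (((i + 1) * α (i + 1)) • ((n + 2 * l - 2 * i) • c.hyp.D (c.x (N - i - 1) i u)
          - (2 : ℂ) • c.hyp.i (c.hyp.d (c.x (N - i - 1) i u))
          + (2 : ℂ) • c.hyp.e (c.y (N - i - 1) i u)) +
        ((N - i) * α i) • c.hyp.corr (n + 1 + 2 * l - 2 * i - 2 * N) (c.x (N - i - 1) i u))
      = (2 : ℂ) • ∑ i ∈ Finset.range (M + 1), ((β i + γ i) • c.hyp.d (c.hyp.i (c.x (M - i) i u))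
        + β i • c.hyp.e (c.y (M - i) i u) + γ i • c.hyp.e (c.hyp.δ (c.x (M - i) i u))) := by
    rw [Finset.smul_sum]
    refine Finset.sum_congr rfl fun i hi => ?_
    have h := hα i (Finset.mem_range.1 hi)
    simp only [ConfCalc.corr, c.hyp.d_i, hsub, hβ, hγ]
    linear_combination (norm := module) h • c.hyp.D (c.x (M - i) i u)
  -- The errors in the two lower sums have terms in `D d δ x` and `D d y`. The recursion at `i`
  -- removes the first and at `i + 1` the second, and what remains is `d i Δ x`. The summand `i = M`
  -- added on the right is zero.
  have hF2 : c.hyp.d (c.hyp.δ (∑ i ∈ Finset.range M,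
        (((i + 1) * γ (i + 1)) • ((n + 2 * l - 2 * i) • c.hyp.D (c.x (M - i - 1) i u)
          - (2 : ℂ) • c.hyp.i (c.hyp.d (c.x (M - i - 1) i u))
          + (2 : ℂ) • c.hyp.e (c.y (M - i - 1) i u)) +
        ((M - i) * γ i) • c.hyp.corr (n + 1 + 2 * l - 2 * i - 2 * M) (c.x (M - i - 1) i u))))
      + c.hyp.d (∑ i ∈ Finset.range M,
        (((i + 1) * β (i + 1)) • ((n + 2 * l - 2 * i - 2) • c.hyp.D (c.y (M - i - 1) i u)
          - (2 : ℂ) • c.hyp.i (c.hyp.d (c.y (M - i - 1) i u))) +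
        ((M - i) * β i) • c.hyp.corr (n - 1 + 2 * l - 2 * i - 2 * M) (c.y (M - i - 1) i u)))
      = ∑ i ∈ Finset.range (M + 1),
        (2 * (M - i) * (β i + γ i)) • c.hyp.d (c.hyp.i (c.x (M - i) i u)) := by
    rw [Finset.sum_range_succ, map_sum, map_sum, map_sum, ← Finset.sum_add_distrib, sub_self,
      mul_zero, zero_mul, zero_smul, add_zero]
    refine Finset.sum_congr rfl fun i hi => ?_
    have hi' : i < M := Finset.mem_range.1 hi
    have h := hα i (by omega)
    have h' := hα (i + 1) (by omega)
    have hx : c.x (M - i) i u = c.hyp.lap (c.x (M - i - 1) i u) := by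
      rw [lap_x, show M - i - 1 + 1 = M - i by omega]
    rw [hx]
    push_cast at h'
    simp only [ConfCalc.corr, map_add, map_sub, map_smul, map_neg, c.hyp.d_i, c.hyp.δ_i,
      c.hyp.δ_e, c.hyp.d_e, c.hyp.δ_D, c.hyp.d_D, c.hyp.δ_d, c.hyp.d_d, c.hyp.δ_δ, map_zero,
      hβ, hγ, hNM]
    rw [hNM] at h h'
    push_cast
    linear_combination (norm := module) (((M : ℂ) - i) * h) •
      c.hyp.D (c.hyp.d (c.hyp.δ (c.x (M - i - 1) i u)))
      + (((i : ℂ) + 1) * h') • c.hyp.D (c.hyp.d (c.y (M - i - 1) i u))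
  -- All remaining errors cancel. For the exterior products this forces the prefactor `l + p - 2N`:
  -- it is the weight plus the degree, `(l - 2M - 1) + (p - 1)`, occurring when `d` passes `ρ`. For
  -- the terms `d i x` it is the recursion once more.
  have hF3 : (2 * (l + p - 2 * N)) • ∑ i ∈ Finset.range (M + 1),
        ((β i + γ i) • c.hyp.d (c.hyp.i (c.x (M - i) i u))
        + β i • c.hyp.e (c.y (M - i) i u) + γ i • c.hyp.e (c.hyp.δ (c.x (M - i) i u)))
      - (2 * (l + p - 2 * N)) •
        (c.hyp.e (c.hyp.δ (∑ i ∈ Finset.range (M + 1), γ i • c.x (M - i) i u))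
        + c.hyp.e (∑ i ∈ Finset.range (M + 1), β i • c.y (M - i) i u))
      + (2 * (n - 1 + l - 2 * M - p)) •
        c.hyp.d (c.hyp.i (∑ i ∈ Finset.range (M + 1), γ i • c.x (M - i) i u))
      + (2 : ℂ) • c.hyp.d (∑ i ∈ Finset.range (M + 1),
        (β i * (n + l - p)) • c.hyp.i (c.x (M - i) i u))
      + (2 : ℂ) • ∑ i ∈ Finset.range (M + 1),
        (2 * (M - i) * (β i + γ i)) • c.hyp.d (c.hyp.i (c.x (M - i) i u)) = 0 := by
    simp only [map_sum, Finset.smul_sum, ← Finset.sum_add_distrib, ← Finset.sum_sub_distrib]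
    refine Finset.sum_eq_zero fun i hi => ?_
    have h := hα i (Finset.mem_range.1 hi)
    simp only [map_smul, hβ, hγ, hNM] at h ⊢
    linear_combination (norm := module) ((2:ℂ) * h) • c.hyp.d (c.hyp.i (c.x (M - i) i u))
  rw [hF1]
  rw [← hF2] at hF3
  simp only [map_add, c.hyp.δ_ρ, c.hyp.d_ρ, map_smul, c.hyp.P_δ, hX, hY, map_sub] at hF3 ⊢
  rw [show l - 2 * (M : ℂ) - 1 - 1 = l - 2 * N by rw [hNM]; ring]
  rw [hNM] at hF3 ⊢
  linear_combination (norm := module) (1:ℂ) • hF3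
end RestrCalc

end SymBreak

namespace SymBreak

/-! ### Identities for the coefficients -/

/-- This recursion is the only property of the `α_i` that equivariance needs. -/
lemma alphaCoeff_succ (n N i : ℕ) (lam : ℂ) (hi : i < N) :
    (i + 1) * alphaCoeff n N (i + 1) lam * (2 * lam + n - 2 * i - 2)
      = -((N - i) * alphaCoeff n N i lam * (2 * lam + n - 2 * i - 1 - 2 * N)) := by
  have h1 : ∏ k ∈ Finset.Icc (i + 1) N, (2 * lam + n - 2 * (k : ℂ)) =
      (2 * lam + n - 2 * i - 2) * ∏ k ∈ Finset.Icc (i + 1 + 1) N, (2 * lam + n - 2 * (k : ℂ)) := by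
    rw [Finset.Icc_add_one_left_eq_Ioc (i + 1), ← Finset.mul_prod_Ioc_eq_prod_Icc (by omega)]
    push_cast
    ring
  have h2 : ∏ k ∈ Finset.Icc 1 (i + 1), (2 * lam + n - 2 * (k : ℂ) - 2 * N + 1) =
      (∏ k ∈ Finset.Icc 1 i, (2 * lam + n - 2 * (k : ℂ) - 2 * N + 1))
        * (2 * lam + n - 2 * i - 1 - 2 * N) := by
    rw [Finset.prod_Icc_succ_top (by omega)]
    push_cast
    ring
  have h3 : (N.choose (i + 1) : ℂ) * (i + 1) = N.choose i * (N - i) := by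
    have := Nat.choose_succ_right_eq N i
    rw [← Nat.cast_sub hi.le]
    exact_mod_cast this
  simp only [alphaCoeff]
  rw [h1, h2, pow_succ]
  linear_combination (-1) ^ (i + 1) * 2 ^ N * ((N.factorial : ℂ) / ((2 * N).factorial : ℂ))
    * (2 * lam + n - 2 * i - 2) * (∏ k ∈ Finset.Icc (i + 1 + 1) N, (2 * lam + n - 2 * (k : ℂ)))
    * (∏ k ∈ Finset.Icc 1 i, (2 * lam + n - 2 * (k : ℂ) - 2 * N + 1))
    * (2 * lam + n - 2 * i - 1 - 2 * N) * h3

lemma prod_range_sub_eq (r : ℂ) (k : ℕ) :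
    ∏ l ∈ Finset.range k, (r - l) = k.factorial * Ring.choose r k := by
  rw [← nsmul_eq_mul, ← Ring.descPochhammer_eq_factorial_smul_choose]
  induction k with
  | zero => simp
  | succ k ih =>
    rw [Finset.prod_range_succ, ih, descPochhammer_succ_right, Polynomial.smeval_mul,
      Polynomial.smeval_sub, Polynomial.smeval_X, Polynomial.smeval_natCast]
    simp

/-- Both products are falling factorials up to powers of two. As generalized binomial coefficients
their lower indices add up to `N`, the shape required by Chu–Vandermonde. -/
lemma alphaCoeff_eq_choose (n N i : ℕ) (lam : ℂ) (hi : i ≤ N) :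
    alphaCoeff n N i lam = (-4) ^ N * (N.factorial : ℂ) ^ 2 / ((2 * N).factorial : ℂ)
      * (Ring.choose (lam + n / 2 - N - 1 / 2) i * Ring.choose (N - lam - n / 2) (N - i)) := by
  have h1 : ∏ k ∈ Finset.Icc (i + 1) N, (2 * lam + n - 2 * (k : ℂ)) =
      (-2) ^ (N - i) * ((N - i).factorial * Ring.choose (N - lam - n / 2) (N - i)) := by
    rw [← prod_range_sub_eq, ← Finset.card_range (N - i), ← Finset.prod_const, Finset.card_range,
      ← Finset.prod_mul_distrib, ← Finset.prod_range_reflect, Finset.Icc_add_one_left_eq_Ioc,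
      ← Finset.Ico_add_one_add_one_eq_Ioc, Finset.prod_Ico_eq_prod_range,
      show N + 1 - (i + 1) = N - i by omega]
    refine Finset.prod_congr rfl fun k hk => ?_
    have hk' := Finset.mem_range.1 hk
    rw [Nat.cast_sub (by omega), Nat.cast_sub (by omega), Nat.cast_sub hi]
    push_cast
    ring
  have h2 : ∏ k ∈ Finset.Icc 1 i, (2 * lam + n - 2 * (k : ℂ) - 2 * N + 1) =
      2 ^ i * (i.factorial * Ring.choose (lam + n / 2 - N - 1 / 2) i) := by
    rw [← prod_range_sub_eq, ← Finset.card_range i, ← Finset.prod_const, Finset.card_range,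
      ← Finset.prod_mul_distrib, ← Finset.Ico_add_one_right_eq_Icc, Finset.prod_Ico_eq_prod_range,
      Nat.add_sub_cancel]
    refine Finset.prod_congr rfl fun k hk => ?_
    push_cast
    ring
  have h3 : (N.factorial : ℂ) = N.choose i * i.factorial * (N - i).factorial := by
    exact_mod_cast (Nat.choose_mul_factorial_mul_factorial hi).symm
  have h4 : (-4 : ℂ) ^ N = (-1) ^ i * 2 ^ N * (-2) ^ (N - i) * 2 ^ i := by
    obtain ⟨k, rfl⟩ := Nat.exists_eq_add_of_le hi
    rw [Nat.add_sub_cancel_left, show (-4 : ℂ) = (-1) * 2 * 2 by norm_num,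
      show (-2 : ℂ) = (-1) * 2 by norm_num]
    simp only [mul_pow, pow_add]
    ring
  rw [alphaCoeff, h1, h2, h4, pow_two]
  nth_rewrite 3 [h3]
  ring

/-- The two upper arguments in the Chu–Vandermonde sum add up to `-1/2 - j'`, free of `λ`. The
half-integer binomial coefficient is a ratio of factorials. -/
lemma factorial_mul_choose_half (j' j : ℕ) :
    (-4 : ℂ) ^ j * (j.factorial * Ring.choose (-1 / 2 - j' : ℂ) j)
      * ((j + j').factorial * (2 * j').factorial) = (2 * (j + j')).factorial * j'.factorial := by
  rw [← prod_range_sub_eq]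
  induction j with
  | zero => simp; ring
  | succ j ih =>
    have h1 : ((2 * (j + 1 + j')).factorial : ℂ) =
        (2 * (j + j') + 2) * (2 * (j + j') + 1) * (2 * (j + j')).factorial := by
      rw [show 2 * (j + 1 + j') = 2 * (j + j') + 1 + 1 by ring, Nat.factorial_succ,
        Nat.factorial_succ]
      push_cast
      ring
    have h2 : ((j + 1 + j').factorial : ℂ) = (j + j' + 1) * (j + j').factorial := by
      rw [show j + 1 + j' = j + j' + 1 by ring, Nat.factorial_succ]
      push_cast
      ring
    rw [h1, h2, Finset.prod_range_succ, pow_succ]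
    linear_combination (2 * ((j : ℂ) + j') + 2) * (2 * (j + j') + 1) * ih

lemma evenGegenbauer_eq_choose (n N j : ℕ) (lam : ℂ) (hj : j ≤ N) :
    evenGegenbauer n N j lam = (-4) ^ (N - j) * ((N.factorial : ℂ) * (N - j).factorial
      / ((j.factorial : ℂ) * ((2 * (N - j)).factorial : ℂ)))
      * Ring.choose (lam + n / 2 - N - 1 / 2) (N - j) := by
  have h1 : ∏ k ∈ Finset.Ico j N, (2 * lam - 4 * N + 2 * (k : ℂ) + n + 1) =
      2 ^ (N - j) * ((N - j).factorial * Ring.choose (lam + n / 2 - N - 1 / 2) (N - j)) := by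
    rw [← prod_range_sub_eq, ← Finset.card_range (N - j), ← Finset.prod_const, Finset.card_range,
      ← Finset.prod_mul_distrib, ← Finset.prod_range_reflect, Finset.prod_Ico_eq_prod_range]
    refine Finset.prod_congr rfl fun k hk => ?_
    have hk' := Finset.mem_range.1 hk
    rw [Nat.cast_sub (by omega), Nat.cast_sub (by omega), Nat.cast_sub hj]
    push_cast
    ring
  rw [evenGegenbauer, h1, show (-4 : ℂ) = (-2) * 2 by norm_num, mul_pow]
  ring

/-- With `k = N - j`, the absorption `C(i,k) C(w,i) = C(w,k) C(w-k,i-k)` pulls out `C(w,k)`, which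
carries the whole dependence on `λ`. Chu–Vandermonde sums the rest to `C(-1/2 - k, j)`. -/
theorem sum_alphaCoeff_mul_choose (n N j : ℕ) (lam : ℂ) (hj : j ≤ N) :
    ∑ i ∈ Finset.range (N + 1), alphaCoeff n N i lam * (i.choose (N - j) : ℂ)
      = evenGegenbauer n N j lam := by
  obtain ⟨k, rfl⟩ := Nat.exists_eq_add_of_le hj
  set w := lam + n / 2 - (j + k : ℕ) - 1 / 2 with hw
  have hV := Ring.add_choose_eq (r := w - k) (s := ((j + k : ℕ) : ℂ) - lam - n / 2) j
    (Commute.all _ _)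
  rw [show w - k + (((j + k : ℕ) : ℂ) - lam - n / 2) = -1 / 2 - k by rw [hw]; ring,
    Finset.Nat.sum_antidiagonal_eq_sum_range_succ_mk] at hV
  rw [evenGegenbauer_eq_choose _ _ _ _ hj, Nat.add_sub_cancel_left, ← hw]
  have h1 : ∀ i ∈ Finset.range (j + k + 1), alphaCoeff n (j + k) i lam * (i.choose k : ℂ) =
      (-4) ^ (j + k) * ((j + k).factorial : ℂ) ^ 2 / ((2 * (j + k)).factorial : ℂ)
      * ((i.choose k : ℂ) * Ring.choose w i
        * Ring.choose (((j + k : ℕ) : ℂ) - lam - n / 2) (j + k - i)) := by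
    intro i hi
    rw [alphaCoeff_eq_choose _ _ _ _ (by simpa [Nat.lt_succ_iff] using hi)]
    ring
  -- The terms with `i < k` vanish because of the factor `C(i,k)`.
  rw [Finset.sum_congr rfl h1, ← Finset.mul_sum, show j + k + 1 = k + (j + 1) by ring,
    Finset.sum_range_add, Finset.sum_eq_zero (fun i hi => by
      rw [Nat.choose_eq_zero_of_lt (Finset.mem_range.1 hi)]; simp), zero_add]
  have h2 : ∀ i ∈ Finset.range (j + 1), ((k + i).choose k : ℂ) * Ring.choose w (k + i)
        * Ring.choose (((j + k : ℕ) : ℂ) - lam - n / 2) (j + k - (k + i)) =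
      Ring.choose w k * (Ring.choose (w - k) i
        * Ring.choose (((j + k : ℕ) : ℂ) - lam - n / 2) (j - i)) := by
    intro i _
    rw [← nsmul_eq_mul, Ring.choose_smul_choose w (Nat.le_add_right k i),
      Nat.add_sub_cancel_left, show j + k - (k + i) = j - i by omega]
    ring
  rw [Finset.sum_congr rfl h2, ← Finset.mul_sum, ← hV]
  have h3 := factorial_mul_choose_half k j
  generalize Ring.choose (-1 / 2 - (k : ℂ)) j = C at h3 ⊢
  have h4 : ∀ a : ℕ, (a.factorial : ℂ) ≠ 0 := fun a => by exact_mod_cast a.factorial_ne_zero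
  have := h4 j; have := h4 k; have := h4 (2 * k); have := h4 (2 * (j + k)); have := h4 (j + k)
  field_simp
  rw [pow_add]
  linear_combination Ring.choose w k * (-4) ^ k * h3

/-- Lowering both `N` and `λ` by one leaves the linear factors of the Gegenbauer products unchanged
up to an index shift. So all three coefficient families reduce to `evenGegenbauer` at level `N`. -/
lemma rCoeff_eq (n N j : ℕ) (lam : ℂ) (hj : j < N) :
    rCoeff n N j (lam - 1) = 2 * (j + 1) * evenGegenbauer n N (j + 1) lam := by
  obtain ⟨k, rfl⟩ := Nat.exists_eq_add_of_lt hj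
  have h4 : ∀ a : ℕ, (a.factorial : ℂ) ≠ 0 := fun a => by exact_mod_cast a.factorial_ne_zero
  rw [rCoeff, evenGegenbauer, evenGegenbauer, Finset.prod_Ico_eq_prod_range,
    Finset.prod_Ico_eq_prod_range, Nat.add_sub_cancel, show j + k + 1 - (j + 1) = k by omega,
    Nat.add_sub_cancel_left, Nat.factorial_succ (j + k), Nat.factorial_succ j]
  have h5 : ∀ l : ℕ, 2 * (lam - 1) - 4 * ((j + k : ℕ) : ℂ) + 2 * ((j + l : ℕ) : ℂ) + n + 1 =
      2 * lam - 4 * ((j + k + 1 : ℕ) : ℂ) + 2 * ((j + 1 + l : ℕ) : ℂ) + n + 1 := by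
    intro l; push_cast; ring
  simp only [h5]
  have := h4 j
  have : (j : ℂ) + 1 ≠ 0 := by exact_mod_cast j.succ_ne_zero
  have := h4 (2 * k)
  push_cast
  field_simp

lemma qCoeff_eq (n N j : ℕ) (lam : ℂ) (hj : j < N) :
    qCoeff n N j (lam - 1) = 2 * (N - j) * evenGegenbauer n N j lam := by
  obtain ⟨k, rfl⟩ := Nat.exists_eq_add_of_lt hj
  have h4 : ∀ a : ℕ, (a.factorial : ℂ) ≠ 0 := fun a => by exact_mod_cast a.factorial_ne_zero
  rw [qCoeff, evenGegenbauer, oddGegenbauer, Finset.prod_Ico_eq_prod_range,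
    Finset.prod_Ico_eq_prod_range, Nat.add_sub_cancel, show j + k + 1 - j = k + 1 by omega,
    Nat.add_sub_cancel_left, Nat.factorial_succ (j + k), Finset.prod_range_succ,
    show 2 * (k + 1) = 2 * k + 1 + 1 by ring, Nat.factorial_succ (2 * k + 1)]
  have h5 : ∀ l : ℕ, 2 * (lam - 1) - 4 * ((j + k : ℕ) : ℂ) + 2 * ((j + l : ℕ) : ℂ) + n - 1 =
      2 * lam - 4 * ((j + k + 1 : ℕ) : ℂ) + 2 * ((j + l : ℕ) : ℂ) + n + 1 := by
    intro l; push_cast; ring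
  simp only [h5]
  have := h4 j
  have := h4 (2 * k + 1)
  have : (2 * (k : ℂ) + 1 + 1) ≠ 0 := by exact_mod_cast (2 * k + 1).succ_ne_zero
  push_cast
  field_simp
  ring

end SymBreak

namespace SymBreak

/-! ### Insertion and exterior multiplication -/

variable {n p : ℕ}

/-- Alternating forms on `ℝⁿ`. -/
abbrev Alt (n p : ℕ) : Type := Euc n [⋀^Fin p]→L[ℝ] ℂ

/-- The insertion of a vector. -/
def insCLM : Euc n →L[ℝ] Alt n (p + 1) →L[ℝ] Alt n p :=
  (ContinuousAlternatingMap.curryLeftLI (𝕜 := ℝ) (E := Euc n) (F := ℂ)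
      (n := p)).toContinuousLinearMap.flip

lemma insCLM_apply (v : Euc n) (a : Alt n (p + 1)) : insCLM v a = a.curryLeft v := rfl

lemma insCLM_complex_smul (v : Euc n) (c : ℂ) (a : Alt n (p + 1)) :
    insCLM v (c • a) = c • insCLM v a := by
  ext; simp [insCLM_apply]

/-- The alternatization of a linear map with values in alternating forms. -/
abbrev altz (f : Euc n →L[ℝ] Alt n p) : Alt n (p + 1) :=
  ContinuousAlternatingMap.alternatizeUncurryFin f

/-- The exterior product with the covector that corresponds to a vector. -/
def extCLM : Euc n →L[ℝ] Alt n p →L[ℝ] Alt n (p + 1) :=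
  LinearMap.toContinuousLinearMap
    { toFun := fun v => (ContinuousAlternatingMap.alternatizeUncurryFinCLM ℝ (Euc n) ℂ).comp
        (ContinuousLinearMap.smulRightL ℝ (Euc n) (Alt n p) (innerSL ℝ v))
      map_add' := fun v w => by simp
      map_smul' := fun c v => by simp }

lemma extCLM_apply (v : Euc n) (a : Alt n p) :
    extCLM v a = altz ((innerSL ℝ v).smulRight a) := rfl

lemma extCLM_complex_smul (v : Euc n) (c : ℂ) (a : Alt n p) :
    extCLM v (c • a) = c • extCLM v a := by
  ext; simp [extCLM_apply, ContinuousAlternatingMap.alternatizeUncurryFin_apply, Finset.mul_sum]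
  refine Finset.sum_congr rfl fun i _ => ?_
  ring

lemma insCLM_altz_zero (f : Euc n →L[ℝ] Alt n 0) (v : Euc n) : insCLM v (altz f) = f v := by
  ext w
  simp [insCLM_apply, ContinuousAlternatingMap.alternatizeUncurryFin_apply]

/-- In the alternating sum, `v` either goes into the linear slot or stays in the form. This is the
pointwise source of Cartan's formula and of the Clifford relation between insertion and exterior
product. -/
lemma insCLM_altz (f : Euc n →L[ℝ] Alt n (p + 1)) (v : Euc n) :
    insCLM v (altz f) = f v - altz ((insCLM v).comp f) := by
  ext w
  simp only [insCLM_apply, ContinuousAlternatingMap.curryLeft_apply_apply,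
    ContinuousAlternatingMap.alternatizeUncurryFin_apply, Fin.sum_univ_succ (n := p + 1),
    ContinuousAlternatingMap.sub_apply, ContinuousLinearMap.comp_apply]
  have h : ∀ i : Fin (p + 1), (Fin.succ i).removeNth (Matrix.vecCons v w) =
      Matrix.vecCons v (i.removeNth w) := by
    intro i
    ext j : 1
    refine Fin.cases ?_ (fun j => ?_) j <;> simp [Fin.removeNth, Matrix.vecCons]
  simp [h, pow_succ, sub_eq_add_neg]

lemma insCLM_extCLM_zero (v w : Euc n) (a : Alt n 0) :
    insCLM v (extCLM w a) = (inner ℝ w v : ℝ) • a := by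
  rw [extCLM_apply, insCLM_altz_zero]; rfl

lemma insCLM_extCLM (v w : Euc n) (a : Alt n (p + 1)) :
    insCLM v (extCLM w a) = (inner ℝ w v : ℝ) • a - extCLM w (insCLM v a) := by
  rw [extCLM_apply, insCLM_altz, extCLM_apply]
  congr 2

lemma insCLM_insCLM (v w : Euc n) (a : Alt n (p + 2)) :
    insCLM v (insCLM w a) = -insCLM w (insCLM v a) := by
  have h : ∀ v, insCLM v (insCLM v a) = 0 := fun v => a.curryLeft_same v
  have h' := h (v + w)
  simp only [map_add, add_apply, h] at h'
  rw [eq_neg_iff_add_eq_zero, add_comm]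
  simpa using h'

lemma sum_inner_basisVec_smul (v : Euc n) :
    ∑ j, (inner ℝ (basisVec j) v : ℝ) • (basisVec j : Euc n) = v := by
  have := (EuclideanSpace.basisFun (Fin n) ℝ).sum_repr' v
  simpa using this

lemma sum_inner_smul_apply {F : Type*} [NormedAddCommGroup F] [NormedSpace ℝ F]
    (f : Euc n →L[ℝ] F) (v : Euc n) :
    ∑ j, (inner ℝ (basisVec j) v : ℝ) • f (basisVec j) = f v := by
  conv_rhs => rw [← sum_inner_basisVec_smul v]
  simp only [map_sum, map_smul]

/-- The derivation of alternating forms that is induced by an endomorphism. -/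
abbrev derivCLM (A : Euc n →L[ℝ] Euc n) (a : Alt n p) : Alt n p :=
  a.fderivCompContinuousLinearMap (ContinuousLinearMap.id ℝ _) A

lemma derivCLM_zero (A : Euc n →L[ℝ] Euc n) (a : Alt n 0) : derivCLM A a = 0 := by
  ext; simp

lemma derivCLM_succ (A : Euc n →L[ℝ] Euc n) (a : Alt n (p + 1)) :
    derivCLM A a = altz (a.curryLeft.comp A) := by
  rw [derivCLM, ContinuousAlternatingMap.fderivCompContinuousLinearMap_eq_alternatizeUncurryFin]
  rfl

/-- The left side is the derivation induced by the transpose of `A`. The hypothesis says that this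
transpose is `2s - A`, and the identity acts as a derivation by the degree `p + 1`. -/
lemma sum_extCLM_insCLM (A : Euc n →L[ℝ] Euc n) (s : ℝ)
    (hA : ∀ u v, (inner ℝ (A u) v : ℝ) + inner ℝ u (A v) = 2 * s * inner ℝ u v)
    (a : Alt n (p + 1)) :
    ∑ j, extCLM (A (basisVec j)) (insCLM (basisVec j) a)
      = (2 * s * (p + 1)) • a - derivCLM A a := by
  have h : ∑ j, (innerSL ℝ (A (basisVec j))).smulRight (insCLM (basisVec j) a)
      = (2 * s) • a.curryLeft - a.curryLeft.comp A := by
    ext v : 1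
    have h1 : ∀ j : Fin n, (inner ℝ (A (basisVec j)) v : ℝ) =
        2 * s * inner ℝ (basisVec j) v - inner ℝ (basisVec j) (A v) := fun j => by
      linarith [hA (basisVec j) v]
    simp only [sum_apply, ContinuousLinearMap.smulRight_apply,
      innerSL_apply_apply, h1, sub_smul, Finset.sum_sub_distrib, mul_smul, ← Finset.smul_sum,
      insCLM_apply, sum_inner_smul_apply]
    rfl
  simp only [extCLM_apply, altz, ← ContinuousAlternatingMap.alternatizeUncurryFinCLM_apply,
    ← map_sum]
  rw [h, map_sub, map_smul]
  simp only [ContinuousAlternatingMap.alternatizeUncurryFinCLM_apply, derivCLM_succ,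
    ContinuousAlternatingMap.alternatizeUncurryFin_curryLeft, altz]
  congr 1
  rw [← Nat.cast_smul_eq_nsmul ℝ, smul_smul, Nat.cast_succ]

end SymBreak

namespace SymBreak

/-! ### Operators on smooth differential forms of mixed degree -/

variable {n p : ℕ}

/-- The submodule of smooth differential forms of mixed degree on `ℝⁿ`. -/
def smoothSubmodule (n : ℕ) : Submodule ℂ (∀ p, Form n p) where
  carrier := {η | ∀ p, ContDiff ℝ ∞ (η p)}
  add_mem' h h' p := (h p).add (h' p)
  zero_mem' _ := contDiff_const
  smul_mem' c _ h p := (h p).const_smul c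

/-- The smooth differential forms of mixed degree on `ℝⁿ`. -/
def SmoothForms (n : ℕ) : Type := smoothSubmodule n

instance : AddCommGroup (SmoothForms n) := inferInstanceAs (AddCommGroup (smoothSubmodule n))
instance : Module ℂ (SmoothForms n) := inferInstanceAs (Module ℂ (smoothSubmodule n))

lemma contDiff_bilinear {F G H : Type*} [NormedAddCommGroup F] [NormedSpace ℝ F]
    [NormedAddCommGroup G] [NormedSpace ℝ G] [NormedAddCommGroup H] [NormedSpace ℝ H]
    (B : F →L[ℝ] G →L[ℝ] H) {f : Euc n → F} {g : Euc n → G} (hf : ContDiff ℝ ∞ f)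
    (hg : ContDiff ℝ ∞ g) : ContDiff ℝ ∞ (fun x => B (f x) (g x)) :=
  (B.contDiff.comp hf).clm_apply hg

lemma two_le_infty : (2 : WithTop ℕ∞) ≤ ∞ :=
  WithTop.coe_le_coe.2 (le_top : (2 : ℕ∞) ≤ ⊤)

lemma minSmoothness_two_le : minSmoothness ℝ 2 ≤ ∞ := by
  rw [minSmoothness_of_isRCLikeNormedField]
  exact two_le_infty

lemma contDiff_fderiv_apply_const {F : Type*} [NormedAddCommGroup F] [NormedSpace ℝ F]
    {f : Euc n → F} (hf : ContDiff ℝ ∞ f) (v : Euc n) :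
    ContDiff ℝ ∞ (fun x => fderiv ℝ f x v) :=
  (hf.fderiv_right (m := ∞) (by norm_num)).clm_apply contDiff_const

lemma extD_eq (η : Form n p) : extD η = fun x => altz (fderiv ℝ η x) := rfl

lemma contDiff_extD {η : Form n p} (h : ContDiff ℝ ∞ η) : ContDiff ℝ ∞ (extD η) := by
  have h1 : ContDiff ℝ ∞ (fderiv ℝ η) := h.fderiv_right (m := ∞) (by norm_num)
  exact (ContinuousAlternatingMap.alternatizeUncurryFinCLM ℝ (Euc n) ℂ (n := p)).contDiff.comp h1

lemma codiff_eq (η : Form n (p + 1)) :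
    codiff η = fun x => -∑ j, insCLM (basisVec j) (fderiv ℝ η x (basisVec j)) := rfl

lemma contDiff_codiff {η : Form n (p + 1)} (h : ContDiff ℝ ∞ η) : ContDiff ℝ ∞ (codiff η) :=
  (ContDiff.sum fun j _ => (insCLM (basisVec j)).contDiff.comp
    (contDiff_fderiv_apply_const h (basisVec j))).neg

namespace SmoothForms

/-- The component of degree `p`. -/
def app (η : SmoothForms n) (p : ℕ) : Form n p := Subtype.val (p := (· ∈ smoothSubmodule n)) η p

lemma contDiff_app (η : SmoothForms n) (p : ℕ) : ContDiff ℝ ∞ (η.app p) :=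
  Subtype.property (p := (· ∈ smoothSubmodule n)) η p

/-- The smooth form with given components. -/
def ofFun (f : ∀ p, Form n p) (hf : ∀ p, ContDiff ℝ ∞ (f p)) : SmoothForms n :=
  (⟨f, hf⟩ : smoothSubmodule n)

lemma ext' {η θ : SmoothForms n} (h : ∀ p x, η.app p x = θ.app p x) : η = θ :=
  Subtype.ext (p := (· ∈ smoothSubmodule n)) (funext fun p => funext fun x => h p x)

@[simp] lemma add_app (η θ : SmoothForms n) (p : ℕ) (x : Euc n) :
    (η + θ).app p x = η.app p x + θ.app p x := rfl
@[simp] lemma sub_app (η θ : SmoothForms n) (p : ℕ) (x : Euc n) :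
    (η - θ).app p x = η.app p x - θ.app p x := rfl
@[simp] lemma neg_app (η : SmoothForms n) (p : ℕ) (x : Euc n) : (-η).app p x = -η.app p x := rfl
@[simp] lemma zero_app (p : ℕ) (x : Euc n) : (0 : SmoothForms n).app p x = 0 := rfl
@[simp] lemma smul_app (c : ℂ) (η : SmoothForms n) (p : ℕ) (x : Euc n) :
    (c • η).app p x = c • η.app p x := rfl
@[simp] lemma sum_app {ι : Type*} (s : Finset ι) (f : ι → SmoothForms n) (p : ℕ) (x : Euc n) :
    (∑ i ∈ s, f i).app p x = ∑ i ∈ s, (f i).app p x := by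
  classical
  induction s using Finset.induction_on with
  | empty => simp
  | insert a s ha ih => rw [Finset.sum_insert ha, Finset.sum_insert ha, add_app, ih]

/-- A linear operator on smooth forms that is given by its components. -/
def mkHom {k : ℕ} (F : SmoothForms n → ∀ p, Form k p)
    (hF : ∀ η p, ContDiff ℝ ∞ (F η p))
    (hadd : ∀ η θ p x, F (η + θ) p x = F η p x + F θ p x)
    (hsmul : ∀ (c : ℂ) η p x, F (c • η) p x = c • F η p x) : SmoothForms n →ₗ[ℂ] SmoothForms k where
  toFun η := ofFun (F η) (hF η)
  map_add' η θ := ext' (hadd η θ)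
  map_smul' c η := ext' (hsmul c η)

lemma diffAt (η : SmoothForms n) (p : ℕ) (x : Euc n) : DifferentiableAt ℝ (η.app p) x :=
  (η.contDiff_app p).differentiable (by norm_num) x

lemma fderiv_add_app (η θ : SmoothForms n) (p : ℕ) (x : Euc n) :
    fderiv ℝ ((η + θ).app p) x = fderiv ℝ (η.app p) x + fderiv ℝ (θ.app p) x :=
  fderiv_add (diffAt η p x) (diffAt θ p x)

lemma fderiv_smul_app (c : ℂ) (η : SmoothForms n) (p : ℕ) (x : Euc n) :
    fderiv ℝ ((c • η).app p) x = c • fderiv ℝ (η.app p) x :=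
  fderiv_const_smul (diffAt η p x) c

/-- The exterior derivative. -/
def d : SmoothForms n →ₗ[ℂ] SmoothForms n :=
  mkHom (fun η p => match p with
      | 0 => 0
      | p + 1 => extD (η.app p))
    (fun η p => match p with
      | 0 => contDiff_const
      | p + 1 => contDiff_extD (η.contDiff_app p))
    (fun η θ p x => match p with
      | 0 => (add_zero _).symm
      | p + 1 => by
        simp only [extD_eq, fderiv_add_app, altz,
          ContinuousAlternatingMap.alternatizeUncurryFin_add])
    (fun c η p x => match p with
      | 0 => (smul_zero (A := Alt n 0) c).symm
      | p + 1 => by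
        simp only [extD_eq, fderiv_smul_app, altz,
          ContinuousAlternatingMap.alternatizeUncurryFin_smul])

@[simp] lemma d_zero (η : SmoothForms n) : (d η).app 0 = 0 := rfl
@[simp] lemma d_succ_apply (η : SmoothForms n) (x : Euc n) :
    (d η).app (p + 1) x = altz (fderiv ℝ (η.app p) x) := rfl

/-- The co-differential. -/
def δ : SmoothForms n →ₗ[ℂ] SmoothForms n :=
  mkHom (fun η p => codiff (η.app (p + 1)))
    (fun η p => contDiff_codiff (η.contDiff_app (p + 1)))
    (fun η θ p x => by
      simp only [codiff_eq, fderiv_add_app, Finset.sum_add_distrib, neg_add, add_apply, map_add])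
    (fun c η p x => by
      simp only [codiff_eq, fderiv_smul_app, insCLM_complex_smul, Finset.smul_sum, smul_neg,
        smul_apply])

lemma δ_app (η : SmoothForms n) : (δ η).app p = codiff (η.app (p + 1)) := rfl

/-- The derivative in a constant direction. -/
def pd (v : Euc n) : SmoothForms n →ₗ[ℂ] SmoothForms n :=
  mkHom (fun η p x => fderiv ℝ (η.app p) x v)
    (fun η p => contDiff_fderiv_apply_const (η.contDiff_app p) v)
    (fun η θ p x => by rw [fderiv_add_app]; rfl)
    (fun c η p x => by rw [fderiv_smul_app]; rfl)

@[simp] lemma pd_app (v : Euc n) (η : SmoothForms n) (x : Euc n) :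
    (pd v η).app p x = fderiv ℝ (η.app p) x v := rfl

/-- The insertion of a smooth vector field. -/
def insF (V : Euc n → Euc n) (hV : ContDiff ℝ ∞ V) : SmoothForms n →ₗ[ℂ] SmoothForms n :=
  mkHom (fun η p x => insCLM (V x) (η.app (p + 1) x))
    (fun η p => contDiff_bilinear insCLM hV (η.contDiff_app (p + 1)))
    (fun η θ p x => by rw [add_app, map_add])
    (fun c η p x => by rw [smul_app, insCLM_complex_smul])

@[simp] lemma insF_app (V : Euc n → Euc n) (hV : ContDiff ℝ ∞ V) (η : SmoothForms n) (x : Euc n) :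
    (insF V hV η).app p x = insCLM (V x) (η.app (p + 1) x) := rfl

/-- The exterior product with the covector field that corresponds to a smooth vector field. -/
def extF (V : Euc n → Euc n) (hV : ContDiff ℝ ∞ V) : SmoothForms n →ₗ[ℂ] SmoothForms n :=
  mkHom (fun η p => match p with
      | 0 => 0
      | p + 1 => fun x => extCLM (V x) (η.app p x))
    (fun η p => match p with
      | 0 => contDiff_const
      | p + 1 => contDiff_bilinear extCLM hV (η.contDiff_app p))
    (fun η θ p x => match p with
      | 0 => (add_zero _).symm
      | p + 1 => by simp only [add_app, map_add])
    (fun c η p x => match p with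
      | 0 => (smul_zero (A := Alt n 0) c).symm
      | p + 1 => by simp only [smul_app, extCLM_complex_smul])

@[simp] lemma extF_zero (V : Euc n → Euc n) (hV : ContDiff ℝ ∞ V) (η : SmoothForms n) :
    (extF V hV η).app 0 = 0 := rfl
@[simp] lemma extF_succ (V : Euc n → Euc n) (hV : ContDiff ℝ ∞ V) (η : SmoothForms n)
    (x : Euc n) : (extF V hV η).app (p + 1) x = extCLM (V x) (η.app p x) := rfl

/-- The insertion of a constant vector. -/
abbrev ins (v : Euc n) : SmoothForms n →ₗ[ℂ] SmoothForms n := insF (fun _ => v) contDiff_const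

/-- The exterior product with the covector that corresponds to a constant vector. -/
abbrev ext (v : Euc n) : SmoothForms n →ₗ[ℂ] SmoothForms n := extF (fun _ => v) contDiff_const

/-- The multiplication by a smooth function. -/
def mulF (f : Euc n → ℝ) (hf : ContDiff ℝ ∞ f) : SmoothForms n →ₗ[ℂ] SmoothForms n :=
  mkHom (fun η p x => f x • η.app p x) (fun η p => hf.smul (η.contDiff_app p))
    (fun η θ p x => by rw [add_app, smul_add])
    (fun c η p x => by rw [smul_app, smul_comm])

@[simp] lemma mulF_app (f : Euc n → ℝ) (hf : ContDiff ℝ ∞ f) (η : SmoothForms n) (x : Euc n) :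
    (mulF f hf η).app p x = f x • η.app p x := rfl

/-- The degree. -/
def deg : SmoothForms n →ₗ[ℂ] SmoothForms n :=
  mkHom (fun η p x => (p : ℂ) • η.app p x) (fun η p => (η.contDiff_app p).const_smul (p : ℂ))
    (fun η θ p x => by rw [add_app, smul_add])
    (fun c η p x => by rw [smul_app, smul_comm])

@[simp] lemma deg_app (η : SmoothForms n) (x : Euc n) :
    (deg η).app p x = (p : ℂ) • η.app p x := rfl

lemma fderiv_pd_apply (v w : Euc n) (η : SmoothForms n) (x : Euc n) :
    fderiv ℝ ((pd v η).app p) x w = fderiv ℝ (fderiv ℝ (η.app p)) x w v := by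
  have h : DifferentiableAt ℝ (fderiv ℝ (η.app p)) x :=
    ((η.contDiff_app p).fderiv_right (m := 1) (by norm_cast)).differentiable (by norm_num) x
  change fderiv ℝ (fun x => fderiv ℝ (η.app p) x v) x w = _
  rw [fderiv_clm_apply h (by fun_prop)]
  simp

lemma pd_comm (v w : Euc n) (η : SmoothForms n) : pd v (pd w η) = pd w (pd v η) :=
  ext' fun p x => by
    rw [pd_app, pd_app, fderiv_pd_apply, fderiv_pd_apply]
    exact ((η.contDiff_app p).contDiffAt.isSymmSndFDerivAt minSmoothness_two_le).eq v w

lemma fderiv_insF (V : Euc n → Euc n) (hV : ContDiff ℝ ∞ V) (η : SmoothForms n) (x v : Euc n) :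
    fderiv ℝ ((insF V hV η).app p) x v = insCLM (fderiv ℝ V x v) (η.app (p + 1) x)
      + insCLM (V x) (fderiv ℝ (η.app (p + 1)) x v) := by
  have h := (insCLM (n := n) (p := p)).fderiv_of_bilinear (hV.differentiable (by norm_num) x)
    (diffAt η (p + 1) x)
  change fderiv ℝ (fun x => insCLM (V x) (η.app (p + 1) x)) x v = _
  rw [h]
  simp [add_comm]

lemma fderiv_extF (V : Euc n → Euc n) (hV : ContDiff ℝ ∞ V) (η : SmoothForms n) (x v : Euc n) :
    fderiv ℝ ((extF V hV η).app (p + 1)) x v = extCLM (fderiv ℝ V x v) (η.app p x)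
      + extCLM (V x) (fderiv ℝ (η.app p) x v) := by
  have h := (extCLM (n := n) (p := p)).fderiv_of_bilinear (hV.differentiable (by norm_num) x)
    (diffAt η p x)
  change fderiv ℝ (fun x => extCLM (V x) (η.app p x)) x v = _
  rw [h]
  simp [add_comm]

lemma fderiv_mulF (f : Euc n → ℝ) (hf : ContDiff ℝ ∞ f) (η : SmoothForms n) (x : Euc n) :
    fderiv ℝ ((mulF f hf η).app p) x = f x • fderiv ℝ (η.app p) x
      + (fderiv ℝ f x).smulRight (η.app p x) := by
  change fderiv ℝ (fun x => f x • η.app p x) x = _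
  rw [fderiv_fun_smul (hf.differentiable (by norm_num) x) (diffAt η p x)]

/-- Commutators with `δ` thereby reduce to those of constant insertions and directional derivatives.
-/
lemma δ_eq_sum (η : SmoothForms n) : δ η = -∑ j, ins (basisVec j) (pd (basisVec j) η) :=
  ext' fun p x => by simp [δ_app, codiff_eq]

lemma pd_ins (v w : Euc n) (η : SmoothForms n) : pd v (ins w η) = ins w (pd v η) :=
  ext' fun p x => by simp [fderiv_insF]

lemma pd_ext (v w : Euc n) (η : SmoothForms n) : pd v (ext w η) = ext w (pd v η) :=
  ext' fun p x => by
    rcases p with _ | p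
    · simp
    · simp [fderiv_extF]

lemma ins_ins (v w : Euc n) (η : SmoothForms n) : ins v (ins w η) = -ins w (ins v η) :=
  ext' fun p x => by simp [insCLM_insCLM v w]

lemma insF_extF (V W : Euc n → Euc n) (hV : ContDiff ℝ ∞ V) (hW : ContDiff ℝ ∞ W)
    (η : SmoothForms n) (x : Euc n) : (insF V hV (extF W hW η)).app p x =
      (inner ℝ (W x) (V x) : ℝ) • η.app p x - (extF W hW (insF V hV η)).app p x := by
  rcases p with _ | p
  · simp [insCLM_extCLM_zero]
  · simp [insCLM_extCLM]

lemma d_d (η : SmoothForms n) : d (d η) = 0 :=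
  ext' fun p x => by
    rcases p with _ | _ | p
    · simp
    · change extD (0 : Form n 0) x = 0
      simp [extD_eq, ← ContinuousAlternatingMap.alternatizeUncurryFinCLM_apply]
    · exact congrFun (extDeriv_extDeriv (η.contDiff_app p) minSmoothness_two_le) x

lemma d_ins (v : Euc n) (η : SmoothForms n) : d (ins v η) = pd v η - ins v (d η) :=
  ext' fun p x => by
    rcases p with _ | p
    · simp [insCLM_altz_zero]
    · simp only [d_succ_apply, sub_app, pd_app, insF_app, insCLM_altz, sub_sub_cancel]
      congr 1
      ext w : 1
      simp [fderiv_insF]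

lemma δ_ins (v : Euc n) (η : SmoothForms n) : δ (ins v η) = -ins v (δ η) := by
  simp only [δ_eq_sum, pd_ins, map_neg, map_sum, ins_ins v, Finset.sum_neg_distrib, neg_neg]

lemma pd_δ (v : Euc n) (η : SmoothForms n) : pd v (δ η) = δ (pd v η) := by
  simp only [δ_eq_sum, map_neg, map_sum, pd_ins, pd_comm v]

/-- Since `δ` anticommutes with constant insertions and commutes with `∂_j`, moving the outer `δ`
inside shows that `δ²` equals its own negative. -/
lemma δ_δ (η : SmoothForms n) : δ (δ η) = 0 := by
  have h : δ (δ η) = -δ (δ η) := by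
    conv_lhs => rw [δ_eq_sum η, map_neg, map_sum]
    simp only [δ_ins, ← pd_δ, Finset.sum_neg_distrib, neg_neg]
    rw [δ_eq_sum (δ η), neg_neg]
  have h2 : (2 : ℂ) • δ (δ η) = 0 := by
    rw [two_smul]; nth_rewrite 1 [h]; simp
  exact (smul_eq_zero.1 h2).resolve_left two_ne_zero

lemma sum_inner_smul_pd (v : Euc n) (η : SmoothForms n) (p : ℕ) (x : Euc n) :
    ∑ j, (inner ℝ v (basisVec j) : ℝ) • (pd (basisVec j) η).app p x = (pd v η).app p x := by
  have h : ∀ j : Fin n, (inner ℝ v (basisVec j) : ℝ) = inner ℝ (basisVec j) v :=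
    fun j => real_inner_comm _ _
  simp only [h]
  exact sum_inner_smul_apply (fderiv ℝ (η.app p) x) v

end SmoothForms

end SymBreak

/-! ### Exterior multiplication, multiplication by functions and the Lie derivative -/

namespace SymBreak

namespace SmoothForms

variable {n p : ℕ}

/-- For a constant `v`, `∂_v` is the Lie derivative `d i_v + i_v d`, which commutes with `d` because
`d² = 0`. -/
lemma pd_d (v : Euc n) (η : SmoothForms n) : pd v (d η) = d (pd v η) := by
  have h1 := d_ins v (d η)
  have h2 := congrArg d (d_ins v η)
  rw [d_d, map_zero, sub_zero] at h1
  rw [d_d, map_sub] at h2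
  rw [← h1]
  exact (sub_eq_zero.1 h2.symm).symm

lemma δ_ext (v : Euc n) (η : SmoothForms n) : δ (ext v η) = -pd v η - ext v (δ η) :=
  ext' fun p x => by
    simp only [δ_eq_sum, pd_ext, neg_app, sum_app, insF_extF, sub_app, Finset.sum_sub_distrib,
      sum_inner_smul_pd, map_neg, map_sum]
    abel

lemma d_mulF (f : Euc n → ℝ) (hf : ContDiff ℝ ∞ f) (b : Euc n)
    (hb : ∀ x, fderiv ℝ f x = innerSL ℝ b) (η : SmoothForms n) :
    d (mulF f hf η) = ext b η + mulF f hf (d η) :=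
  ext' fun p x => by
    rcases p with _ | p
    · exact ((zero_add _).trans (smul_zero (A := Alt n 0) (f x))).symm
    · simp only [d_succ_apply, fderiv_mulF, add_app, extF_succ, mulF_app, altz,
        ContinuousAlternatingMap.alternatizeUncurryFin_add,
        ContinuousAlternatingMap.alternatizeUncurryFin_smul, hb, extCLM_apply]
      abel

lemma δ_mulF (f : Euc n → ℝ) (hf : ContDiff ℝ ∞ f) (b : Euc n)
    (hb : ∀ x, fderiv ℝ f x = innerSL ℝ b) (η : SmoothForms n) :
    δ (mulF f hf η) = mulF f hf (δ η) - ins b η :=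
  ext' fun p x => by
    have h : ∀ j : Fin n, (inner ℝ b (basisVec j) : ℝ) = inner ℝ (basisVec j) b :=
      fun j => real_inner_comm _ _
    have h' := sum_inner_smul_apply (insCLM.flip (η.app (p + 1) x)) b
    simp only [ContinuousLinearMap.flip_apply] at h'
    simp only [δ_eq_sum, neg_app, sum_app, insF_app, pd_app, fderiv_mulF, sub_app, mulF_app, hb,
      add_apply, smul_apply, ContinuousLinearMap.smulRight_apply, map_add, map_smul,
      innerSL_apply_apply, Finset.sum_add_distrib, h, h', smul_neg, Finset.smul_sum]
    abel

/-- The exterior product with `v` is the commutator of `d` with multiplication by the linear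
function `⟨v, x⟩`. Applying `d² = 0` gives the anticommutation. -/
lemma d_ext (v : Euc n) (η : SmoothForms n) : d (ext v η) = -ext v (d η) := by
  have hf : ContDiff ℝ ∞ (fun x : Euc n => innerSL ℝ v x) := (innerSL ℝ v).contDiff
  have h := d_mulF _ hf v (fun x => (innerSL ℝ v).fderiv)
  have h1 := congrArg d (h η)
  rw [d_d, map_add, h (d η), d_d, map_zero, add_zero] at h1
  exact eq_neg_of_add_eq_zero_left h1.symm

/-- The Lie derivative along a smooth vector field. -/
def lie (V : Euc n → Euc n) (hV : ContDiff ℝ ∞ V) : SmoothForms n →ₗ[ℂ] SmoothForms n :=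
  d ∘ₗ insF V hV + insF V hV ∘ₗ d

lemma lie_apply (V : Euc n → Euc n) (hV : ContDiff ℝ ∞ V) (η : SmoothForms n) :
    lie V hV η = d (insF V hV η) + insF V hV (d η) := rfl

/-- This turns Cartan's formula into the expression that arises by differentiating a pull-back along
a flow. -/
lemma lie_app (V : Euc n → Euc n) (hV : ContDiff ℝ ∞ V) (η : SmoothForms n) (x : Euc n) :
    (lie V hV η).app p x = fderiv ℝ (η.app p) x (V x)
      + derivCLM (fderiv ℝ V x) (η.app p x) := by
  rw [lie_apply]
  rcases p with _ | p
  · simp [insCLM_altz_zero, derivCLM_zero]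
  · have h : fderiv ℝ ((insF V hV η).app p) x = (η.app (p + 1) x).curryLeft.comp (fderiv ℝ V x)
        + (insCLM (V x)).comp (fderiv ℝ (η.app (p + 1)) x) := by
      ext v : 1
      rw [fderiv_insF]
      rfl
    simp only [add_app, d_succ_apply, insF_app, insCLM_altz, h, derivCLM_succ, altz,
      ContinuousAlternatingMap.alternatizeUncurryFin_add]
    abel

lemma d_lie (V : Euc n → Euc n) (hV : ContDiff ℝ ∞ V) (η : SmoothForms n) :
    d (lie V hV η) = lie V hV (d η) := by
  simp [lie_apply, d_d]

end SmoothForms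

/-! ### Conformal vector fields and their commutators with `d` and `δ` -/

/-- A conformal vector field, with its conformal factor and the gradient of the latter. -/
structure ConfField (n : ℕ) where
  V : Euc n → Euc n
  σ : Euc n → ℝ
  b : Euc n
  hV : ContDiff ℝ ∞ V
  hσ : ContDiff ℝ ∞ σ
  hb : ∀ x, fderiv ℝ σ x = innerSL ℝ b
  conf : ∀ x u v, (inner ℝ (fderiv ℝ V x u) v : ℝ) + inner ℝ u (fderiv ℝ V x v)
    = 2 * σ x * inner ℝ u v

namespace ConfField
open SmoothForms

variable {n p : ℕ} (F : ConfField n)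

lemma div_eq (x : Euc n) :
    ∑ j, (inner ℝ (fderiv ℝ F.V x (basisVec j)) (basisVec j) : ℝ) = n * F.σ x := by
  have h : ∀ j : Fin n, (inner ℝ (fderiv ℝ F.V x (basisVec j)) (basisVec j) : ℝ) = F.σ x := by
    intro j
    have := F.conf x (basisVec j) (basisVec j)
    have h1 : (inner ℝ (basisVec j) (basisVec j : Euc n) : ℝ) = 1 := by simp
    rw [h1, real_inner_comm (basisVec j)] at this
    linarith [real_inner_comm (basisVec j) (fderiv ℝ F.V x (basisVec j))]
  simp [h]

/-- This is the dual of Cartan's formula. The derivative of `V` enters through `∑ i_{e_j} (∂_j V ∧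
·)`: its trace gives `n σ`, and conformality replaces the transpose of `DV` by `2σ - DV`, giving the
degree term and the derivation part of `L_V`. -/
lemma δ_extF (η : SmoothForms n) : δ (extF F.V F.hV η) =
    -extF F.V F.hV (δ η) - lie F.V F.hV η - (n : ℂ) • mulF F.σ F.hσ η
      + (2 : ℂ) • mulF F.σ F.hσ (deg η) :=
  ext' fun p x => by
    have h1 : ∀ j : Fin n, insCLM (basisVec j) (fderiv ℝ ((extF F.V F.hV η).app (p + 1)) x
        (basisVec j)) = (insCLM (basisVec j) (extCLM (fderiv ℝ F.V x (basisVec j)) (η.app p x)))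
        + (ins (basisVec j) (extF F.V F.hV (pd (basisVec j) η))).app p x := by
      intro j
      rw [fderiv_extF, map_add]
      rfl
    have h2 : ∑ j : Fin n, insCLM (basisVec j)
        (extCLM (fderiv ℝ F.V x (basisVec j)) (η.app p x))
        = (n * F.σ x) • η.app p x - (2 * F.σ x * p) • η.app p x
          + derivCLM (fderiv ℝ F.V x) (η.app p x) := by
      rcases p with _ | p
      · have h0 : (2 * F.σ x * (0 : ℕ)) • η.app 0 x = 0 := by
          rw [Nat.cast_zero, mul_zero]
          exact zero_smul ℝ (η.app 0 x)
        simp only [insCLM_extCLM_zero, ← Finset.sum_smul, div_eq, derivCLM_zero, h0]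
        abel
      · simp only [insCLM_extCLM, Finset.sum_sub_distrib, ← Finset.sum_smul, div_eq,
          sum_extCLM_insCLM _ _ (F.conf x)]
        push_cast
        abel
    have h3 := sum_inner_smul_pd (F.V x) η p x
    simp only [pd_app] at h3
    rw [δ_app, codiff_eq]
    simp only [h1, Finset.sum_add_distrib, h2, insF_extF, pd_app, h3,
      Finset.sum_sub_distrib, add_app, sub_app, neg_app, smul_app, lie_app, mulF_app, deg_app,
      δ_eq_sum, map_neg, map_sum, sum_app]
    have hc : ∀ (r : ℝ) (a : Alt n p), r • a = (r : ℂ) • a := fun r a => by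
      ext; simp
    simp only [hc]
    push_cast
    module

/-- The infinitesimal conformal action with weight `l`, on forms of mixed degree. -/
def rep (l : ℂ) : SmoothForms n →ₗ[ℂ] SmoothForms n :=
  lie F.V F.hV - mulF F.σ F.hσ ∘ₗ (l • LinearMap.id + deg)

lemma rep_apply (l : ℂ) (η : SmoothForms n) :
    F.rep l η = lie F.V F.hV η - mulF F.σ F.hσ (l • η + deg η) := rfl

lemma deg_d (η : SmoothForms n) : deg (d η) = d (deg η) + d η := by
  have h : ∀ q, fderiv ℝ ((deg η).app q) = fun x => (q : ℂ) • fderiv ℝ (η.app q) x := fun q =>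
    funext fun x => fderiv_const_smul (diffAt η q x) (q : ℂ)
  refine ext' fun p x => ?_
  rcases p with _ | p
  · exact (smul_zero (A := Alt n 0) ((0 : ℕ) : ℂ)).trans (add_zero _).symm
  · simp only [deg_app, d_succ_apply, add_app, h, altz,
      ContinuousAlternatingMap.alternatizeUncurryFin_smul]
    push_cast
    module

lemma deg_δ (η : SmoothForms n) : deg (δ η) = δ (deg η) - δ η := by
  have h : ∀ q x, fderiv ℝ ((deg η).app q) x = (q : ℂ) • fderiv ℝ (η.app q) x := fun q x =>
    fderiv_const_smul (diffAt η q x) (q : ℂ)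
  refine ext' fun p x => ?_
  simp only [deg_app, sub_app, δ_app, codiff_eq, h, smul_apply, insCLM_complex_smul,
    ← Finset.smul_sum]
  push_cast
  module

lemma d_rep (l : ℂ) (η : SmoothForms n) :
    d (F.rep l η) = F.rep (l - 1) (d η) - ext F.b (l • η + deg η) := by
  simp only [rep_apply, map_sub, map_add, map_smul, d_lie, d_mulF _ F.hσ _ F.hb, deg_d]
  module

/-- In this form `δ² = 0` makes the commutator of `δ` with `L_V` computable: only the terms in `σ`
contribute. -/
lemma lie_eq (η : SmoothForms n) : lie F.V F.hV η = -extF F.V F.hV (δ η) - δ (extF F.V F.hV η)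
    - (n : ℂ) • mulF F.σ F.hσ η + (2 : ℂ) • mulF F.σ F.hσ (deg η) := by
  rw [δ_extF]
  abel

lemma δ_rep (l : ℂ) (η : SmoothForms n) :
    δ (F.rep l η) = F.rep (l - 1) (δ η) + ins F.b ((n + l) • η - deg η) := by
  simp only [rep_apply, map_sub, map_add, map_smul, lie_eq, δ_mulF _ F.hσ _ F.hb, deg_δ, δ_δ,
    map_neg, map_zero]
  module

/-- The commutation relations for a conformal vector field. -/
def confCalc (ν : ℂ) (hν : ν = n) : ConfCalc ν (SmoothForms n) where
  d := d
  δ := δ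
  e := SmoothForms.ext F.b
  i := ins F.b
  D := pd F.b
  P := deg
  ρ := F.rep
  d_d := d_d
  δ_δ := δ_δ
  d_i := d_ins F.b
  δ_e := δ_ext F.b
  δ_i := δ_ins F.b
  d_e := d_ext F.b
  d_D := fun η => (pd_d F.b η).symm
  δ_D := fun η => (pd_δ F.b η).symm
  P_d := deg_d
  P_δ := deg_δ
  d_ρ := F.d_rep
  δ_ρ l η := by rw [hν, F.δ_rep]

end ConfField

end SymBreak

/-! ### The geometric formula, and the binomial expansion of restricted powers -/

namespace SymBreak

namespace ConfCalc

variable {n : ℂ} {U : Type*} [AddCommGroup U] [Module ℂ U] (c : ConfCalc n U)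

/-- The operator `d δ`. -/
def dδ : Module.End ℂ U := c.d ∘ₗ c.δ

/-- The operator `δ d`. -/
def δd : Module.End ℂ U := c.δ ∘ₗ c.d

/-- On exact forms `d δ` coincides with `Δ`, so every factor after the first is a Laplacian. The
same holds for `δ d` on co-exact forms. -/
lemma dδ_pow_succ (k : ℕ) (u : U) : (c.dδ ^ (k + 1)) u = c.d (c.δ ((c.lap ^ k) u)) := by
  induction k with
  | zero => simp [dδ]
  | succ k ih =>
    rw [pow_succ', Module.End.mul_apply, ih, pow_succ', Module.End.mul_apply]
    simp [dδ, lap_apply, c.δ_δ]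

lemma δd_pow_succ (k : ℕ) (u : U) : (c.δd ^ (k + 1)) u = c.δ (c.d ((c.lap ^ k) u)) := by
  induction k with
  | zero => simp [δd]
  | succ k ih =>
    rw [pow_succ', Module.End.mul_apply, ih, pow_succ', Module.End.mul_apply]
    simp [δd, lap_apply, c.d_d]

end ConfCalc

namespace RestrCalc

variable {n : ℂ} {U W : Type*} [AddCommGroup U] [Module ℂ U] [AddCommGroup W] [Module ℂ W]
  (c : RestrCalc n U W)

/-- An exact form stays exact after restriction, so all the operators `d δ` on the hyperplane act as
Laplacians. -/
lemma dδ_pow_r_dδ (k i : ℕ) (u : U) :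
    (c.hyp.dδ ^ k) (c.r ((c.amb.dδ ^ (i + 1)) u)) = c.hyp.d (c.y k i u) := by
  rw [c.amb.dδ_pow_succ, c.r_d]
  rcases k with _ | k
  · rfl
  · rw [c.hyp.dδ_pow_succ, c.hyp.pow_comm c.hyp.lap_d, c.hyp.δ_d, map_sub, c.hyp.d_d, sub_zero,
      y, pow_succ']
    rfl

lemma dδ_pow_r (k : ℕ) (u : U) :
    (c.hyp.dδ ^ (k + 1)) (c.r u) = c.hyp.d (c.hyp.δ (c.x k 0 u)) := by
  rw [c.hyp.dδ_pow_succ]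
  rfl

lemma r_δd_pow (i : ℕ) (u : U) :
    c.r ((c.amb.δd ^ (i + 1)) u) = c.g (i + 1) u - c.hyp.d (c.h i u) := by
  rw [c.amb.δd_pow_succ, c.amb.δ_d, map_sub, c.r_d, g, pow_succ']
  rfl

lemma dδ_pow_r_δd (k i : ℕ) (u : U) : (c.hyp.dδ ^ (k + 1)) (c.r ((c.amb.δd ^ (i + 1)) u)) =
    c.hyp.d (c.hyp.δ (c.x k (i + 1) u)) - c.hyp.d (c.y (k + 1) i u) := by
  rw [r_δd_pow, c.hyp.dδ_pow_succ, map_sub, c.hyp.pow_comm c.hyp.lap_d, map_sub, map_sub,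
    c.hyp.δ_d, map_sub, c.hyp.d_d, sub_zero, y, pow_succ']
  rfl

lemma δd_pow_r_δd (k i : ℕ) (u : U) : (c.hyp.δd ^ (k + 1)) (c.r ((c.amb.δd ^ i) u)) =
    c.x (k + 1) i u - c.hyp.d (c.hyp.δ (c.x k i u)) := by
  have h : ∀ w : W, c.hyp.δ (c.hyp.d ((c.hyp.lap ^ k) w)) =
      (c.hyp.lap ^ (k + 1)) w - c.hyp.d (c.hyp.δ ((c.hyp.lap ^ k) w)) := fun w => by
    rw [c.hyp.δ_d, pow_succ']
    rfl
  rw [c.hyp.δd_pow_succ]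
  rcases i with _ | i
  · exact h _
  · rw [r_δd_pow, map_sub, c.hyp.pow_comm c.hyp.lap_d, map_sub, c.hyp.d_d, sub_zero, h]
    rfl

/-- The geometric formula for the symmetry breaking operator with coefficients `α`. -/
def geomOp (l p : ℂ) (N : ℕ) (α : ℕ → ℂ) (u : U) : W :=
  ∑ i ∈ Finset.Icc 1 (N - 1), ((l + p - 2 * i) * α i) •
      (c.hyp.dδ ^ (N - i)) (c.r ((c.amb.δd ^ i) u))
  + (l + p) • ∑ i ∈ Finset.range (N + 1), α i •
      (c.hyp.dδ ^ (N - i)) (c.r ((c.amb.dδ ^ i) u))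
  + (l + p - 2 * N) • ∑ i ∈ Finset.range (N + 1), α i •
      (c.hyp.δd ^ (N - i)) (c.r ((c.amb.δd ^ i) u))

/-- Every product in the geometric formula reduces to `x`, `d δ x` and `d y` terms. The three
weights `l + p - 2i`, `l + p` and `l + p - 2N` are such that only their differences survive on the
last two. -/
theorem geomOp_eq_sbo (l p : ℂ) (M : ℕ) (α : ℕ → ℂ) (u : U) :
    c.geomOp l p (M + 1) α u = c.sbo l p (M + 1) α u := by
  have h1 : ∑ i ∈ Finset.Icc 1 (M + 1 - 1), ((l + p - 2 * i) * α i) •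
      (c.hyp.dδ ^ (M + 1 - i)) (c.r ((c.amb.δd ^ i) u)) =
      ∑ j ∈ Finset.range M, ((l + p - 2 * (j + 1)) * α (j + 1)) •
        (c.hyp.d (c.hyp.δ (c.x (M - (j + 1)) (j + 1) u)) - c.hyp.d (c.y (M - j) j u)) := by
    rw [Nat.add_sub_cancel, ← Finset.Ico_add_one_right_eq_Icc, Finset.sum_Ico_eq_sum_range,
      Nat.add_sub_cancel]
    refine Finset.sum_congr rfl fun j hj => ?_
    have hj' := Finset.mem_range.1 hj
    rw [add_comm 1 j, show M + 1 - (j + 1) = M - (j + 1) + 1 by omega, dδ_pow_r_δd,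
      show M - (j + 1) + 1 = M - j by omega]
    push_cast
    rfl
  have h2 : ∑ i ∈ Finset.range (M + 1 + 1), α i •
      (c.hyp.dδ ^ (M + 1 - i)) (c.r ((c.amb.dδ ^ i) u)) =
      ∑ i ∈ Finset.range (M + 1), α (i + 1) • c.hyp.d (c.y (M - i) i u)
        + α 0 • c.hyp.d (c.hyp.δ (c.x M 0 u)) := by
    rw [Finset.sum_range_succ', Nat.sub_zero, pow_zero, Module.End.one_apply, dδ_pow_r]
    congr 1
    refine Finset.sum_congr rfl fun j _ => ?_
    rw [dδ_pow_r_dδ, Nat.add_sub_add_right]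
  have h3 : ∑ i ∈ Finset.range (M + 1 + 1), α i •
      (c.hyp.δd ^ (M + 1 - i)) (c.r ((c.amb.δd ^ i) u)) =
      ∑ i ∈ Finset.range (M + 1 + 1), α i • c.x (M + 1 - i) i u
      - ∑ i ∈ Finset.range (M + 1), α i • c.hyp.d (c.hyp.δ (c.x (M - i) i u))
      - α (M + 1) • c.hyp.d (c.y 0 M u) := by
    rw [Finset.sum_range_succ, Finset.sum_range_succ _ (M + 1), Nat.sub_self, pow_zero,
      Module.End.one_apply, r_δd_pow]
    have : ∀ i ∈ Finset.range (M + 1), α i •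
        (c.hyp.δd ^ (M + 1 - i)) (c.r ((c.amb.δd ^ i) u)) = α i • c.x (M + 1 - i) i u
        - α i • c.hyp.d (c.hyp.δ (c.x (M - i) i u)) := fun i hi => by
      have hi' := Finset.mem_range.1 hi
      rw [show M + 1 - i = M - i + 1 by omega, δd_pow_r_δd, smul_sub]
    rw [Finset.sum_congr rfl this, Finset.sum_sub_distrib, x, y, pow_zero, Module.End.one_apply,
      Module.End.one_apply]
    module
  rw [geomOp, h1, h2, h3, sbo]
  simp only [show ∀ i, M + 1 - i - 1 = M - i by omega]
  rw [Finset.sum_add_distrib,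
    Finset.sum_range_succ' (fun i => (((M + 1 : ℕ) - i) * α i) •
      c.hyp.d (c.hyp.δ (c.x (M - i) i u))),
    Finset.sum_range_succ' (fun i => α i • c.hyp.d (c.hyp.δ (c.x (M - i) i u))),
    Finset.sum_range_succ (fun i : ℕ => ((i + 1) * α (i + 1)) • c.hyp.d (c.y (M - i) i u)),
    Finset.sum_range_succ (fun i : ℕ => α (i + 1) • c.hyp.d (c.y (M - i) i u)),
    Nat.sub_self, Nat.sub_zero]
  -- For `i = j + 1`, the coefficient of `d δ x` is `(l + p - 2i) - (l + p - 2N) = 2(N - i)`, and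
  -- that of `d y` is `(l + p) - (l + p - 2i) = 2i`. The terms `i = 0` and `i = N`, missing from the
  -- first sum of the geometric formula, were split off above.
  have h4 : ∑ j ∈ Finset.range M, ((l + p - 2 * (j + 1)) * α (j + 1)) •
        (c.hyp.d (c.hyp.δ (c.x (M - (j + 1)) (j + 1) u)) - c.hyp.d (c.y (M - j) j u))
      + (l + p) • ∑ j ∈ Finset.range M, α (j + 1) • c.hyp.d (c.y (M - j) j u)
      - (l + p - 2 * (M + 1 : ℕ)) • ∑ j ∈ Finset.range M,
        α (j + 1) • c.hyp.d (c.hyp.δ (c.x (M - (j + 1)) (j + 1) u))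
      = (2 : ℂ) • (∑ j ∈ Finset.range M, ((((M + 1 : ℕ) : ℂ) - (j + 1 : ℕ)) * α (j + 1)) •
        c.hyp.d (c.hyp.δ (c.x (M - (j + 1)) (j + 1) u))
        + ∑ j ∈ Finset.range M, ((j + 1) * α (j + 1)) • c.hyp.d (c.y (M - j) j u)) := by
    rw [← Finset.sum_add_distrib]
    simp only [Finset.smul_sum, ← Finset.sum_add_distrib, ← Finset.sum_sub_distrib]
    refine Finset.sum_congr rfl fun j _ => ?_
    push_cast
    module
  push_cast at h4 ⊢
  linear_combination (norm := module) (1 : ℂ) • h4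

/-- On `U →ₗ[ℂ] W`, composing with `Δ` on the left and with `Y` on the right are commuting
endomorphisms `A` and `B`. Since `φ ∘ Δ̄ = (A + B) φ`, the binomial theorem for `(A + B)^i` applies.
-/
lemma pow_expand (φ : U →ₗ[ℂ] W) (Y : Module.End ℂ U)
    (hφ : ∀ u, φ (c.amb.lap u) = c.hyp.lap (φ u) + φ (Y u))
    (hY : ∀ u, c.amb.lap (Y u) = Y (c.amb.lap u)) (i : ℕ) (u : U) :
    φ ((c.amb.lap ^ i) u) = ∑ s ∈ Finset.range (i + 1),
      (i.choose s : ℂ) • (c.hyp.lap ^ (i - s)) (φ ((Y ^ s) u)) := by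
  let A : Module.End ℂ (U →ₗ[ℂ] W) := LinearMap.llcomp ℂ U W W c.hyp.lap
  let B : Module.End ℂ (U →ₗ[ℂ] W) := LinearMap.lcomp ℂ W Y
  have hAB : Commute A B := rfl
  have hA : ∀ (k : ℕ) (ψ : U →ₗ[ℂ] W) (u : U), (A ^ k) ψ u = (c.hyp.lap ^ k) (ψ u) := by
    intro k
    induction k with
    | zero => simp
    | succ k ih => intro ψ u; rw [pow_succ, Module.End.mul_apply, ih, pow_succ]; rfl
  have hB : ∀ (k : ℕ) (ψ : U →ₗ[ℂ] W) (u : U), (B ^ k) ψ u = ψ ((Y ^ k) u) := by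
    intro k
    induction k with
    | zero => simp
    | succ k ih => intro ψ u; rw [pow_succ, Module.End.mul_apply, ih, pow_succ']; rfl
  have h : ∀ (i : ℕ) (u : U), φ ((c.amb.lap ^ i) u) = ((A + B) ^ i) φ u := by
    intro i
    induction i with
    | zero => simp
    | succ i ih =>
      intro u
      have hsum : (A + B) φ = φ ∘ₗ c.amb.lap := LinearMap.ext fun u => (hφ u).symm
      have hgen : ∀ (k : ℕ) (ψ : U →ₗ[ℂ] W) (L : Module.End ℂ U) (_ : ∀ u, L (Y u) = Y (L u)),
          ((A + B) ^ k) (ψ ∘ₗ L) = (((A + B) ^ k) ψ) ∘ₗ L := by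
        intro k
        induction k with
        | zero => intros; rfl
        | succ k ihk =>
          intro ψ L hL
          rw [pow_succ, Module.End.mul_apply, Module.End.mul_apply, ← ihk _ _ hL]
          congr 1
          refine LinearMap.ext fun u => ?_
          change c.hyp.lap (ψ (L u)) + ψ (L (Y u)) = c.hyp.lap (ψ (L u)) + ψ (Y (L u))
          rw [hL]
      rw [pow_succ, Module.End.mul_apply, ih, pow_succ (A + B), Module.End.mul_apply, hsum,
        hgen _ _ _ hY]
      rfl
  rw [h, hAB.add_pow', Finset.Nat.sum_antidiagonal_eq_sum_range_succ_mk, LinearMap.sum_apply,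
    LinearMap.sum_apply, ← Finset.sum_range_reflect]
  refine Finset.sum_congr rfl fun s hs => ?_
  have hs' : s ≤ i := by simpa [Nat.lt_succ_iff] using hs
  rw [show i + 1 - 1 - s = i - s by omega, show i - (i - s) = s by omega, Nat.choose_symm hs',
    LinearMap.smul_apply, LinearMap.smul_apply, Module.End.mul_apply, hA, hB,
    Nat.cast_smul_eq_nsmul]

lemma sum_pow_expand (φ : U →ₗ[ℂ] W) (Y : Module.End ℂ U)
    (hφ : ∀ u, φ (c.amb.lap u) = c.hyp.lap (φ u) + φ (Y u))
    (hY : ∀ u, c.amb.lap (Y u) = Y (c.amb.lap u)) (K : ℕ) (a : ℕ → ℂ) (u : U) :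
    ∑ i ∈ Finset.range (K + 1), a i • (c.hyp.lap ^ (K - i)) (φ ((c.amb.lap ^ i) u)) =
      ∑ j ∈ Finset.range (K + 1), (∑ i ∈ Finset.range (K + 1), a i * (i.choose (K - j) : ℂ)) •
        (c.hyp.lap ^ j) (φ ((Y ^ (K - j)) u)) := by
  have h1 : ∀ i ∈ Finset.range (K + 1), a i • (c.hyp.lap ^ (K - i)) (φ ((c.amb.lap ^ i) u)) =
      ∑ s ∈ Finset.range (K + 1), (a i * (i.choose s : ℂ)) •
        (c.hyp.lap ^ (K - s)) (φ ((Y ^ s) u)) := by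
    intro i hi
    have hi' : i ≤ K := by simpa [Nat.lt_succ_iff] using hi
    rw [c.pow_expand φ Y hφ hY, map_sum, Finset.smul_sum]
    refine Finset.sum_subset_zero_on_sdiff (Finset.range_subset_range.2 (by omega)) ?_ ?_
    · intro s hs
      rw [Nat.choose_eq_zero_of_lt (by simpa using (Finset.mem_sdiff.1 hs).2)]
      simp
    · intro s hs
      have hs' : s ≤ i := by simpa [Nat.lt_succ_iff] using hs
      rw [map_smul, ← Module.End.mul_apply, ← pow_add, show K - i + (i - s) = K - s by omega,
        smul_smul]
  rw [Finset.sum_congr rfl h1, Finset.sum_comm, ← Finset.sum_range_reflect]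
  refine Finset.sum_congr rfl fun j hj => ?_
  have hj' : j ≤ K := by simpa [Nat.lt_succ_iff] using hj
  rw [← Finset.sum_smul, show K + 1 - 1 - j = K - j by omega, show K - (K - j) = j by omega]

end RestrCalc

end SymBreak

/-! ### The operator in terms of tangential Laplacians and normal derivatives -/

namespace SymBreak

lemma sum_mul_choose_shift (M j : ℕ) (α : ℕ → ℂ) :
    ∑ i ∈ Finset.range (M + 1), ((i + 1) * α (i + 1)) * (i.choose j : ℂ)
      = (j + 1) * ∑ i ∈ Finset.range (M + 1 + 1), α i * (i.choose (j + 1) : ℂ) := by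
  rw [Finset.sum_range_succ' (fun i => α i * (i.choose (j + 1) : ℂ)) (M + 1), Nat.choose_zero_succ,
    Nat.cast_zero, mul_zero, add_zero, Finset.mul_sum]
  refine Finset.sum_congr rfl fun i _ => ?_
  have h : ((i : ℂ) + 1) * i.choose j = (i + 1).choose (j + 1) * (j + 1) := by
    exact_mod_cast Nat.add_one_mul_choose_eq i j
  linear_combination α (i + 1) * h

/-- Put `s = M - j`. After the shift, each `α i` carries `(M + 1 - i) C(i,s) + (s + 1) C(i,s+1)`,
and `(s + 1) C(i,s+1) = (i - s) C(i,s)` turns this into `(j + 1) C(i,s)`. The extra summand `i = M +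
1` has coefficient zero before the shift. -/
lemma sum_sub_mul_choose (M j : ℕ) (α : ℕ → ℂ) (hj : j ≤ M) :
    ∑ i ∈ Finset.range (M + 1), ((((M + 1 : ℕ) : ℂ) - i) * α i + (i + 1) * α (i + 1))
        * (i.choose (M - j) : ℂ)
      = (j + 1) * ∑ i ∈ Finset.range (M + 1 + 1), α i * (i.choose (M - j) : ℂ) := by
  rw [Finset.sum_congr rfl fun i _ => add_mul _ _ _, Finset.sum_add_distrib, sum_mul_choose_shift]
  have h0 : ∑ i ∈ Finset.range (M + 1), (((M + 1 : ℕ) : ℂ) - i) * α i * (i.choose (M - j) : ℂ) =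
      ∑ i ∈ Finset.range (M + 1 + 1), (((M + 1 : ℕ) : ℂ) - i) * α i * (i.choose (M - j) : ℂ) := by
    rw [Finset.sum_range_succ _ (M + 1)]
    simp
  rw [h0, Finset.mul_sum, Finset.mul_sum, ← Finset.sum_add_distrib]
  refine Finset.sum_congr rfl fun i _ => ?_
  have h : (i.choose (M - j + 1) : ℂ) * (((M : ℂ) - j) + 1) = i.choose (M - j) * (i - (M - j)) := by
    rw [← Nat.cast_sub hj]
    rcases le_or_gt (M - j) i with h | h
    · rw [← Nat.cast_sub h]
      exact_mod_cast Nat.choose_succ_right_eq i (M - j)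
    · rw [Nat.choose_eq_zero_of_lt h, Nat.choose_eq_zero_of_lt (by omega)]
      simp
  rw [Nat.cast_sub hj]
  push_cast
  linear_combination α i * h

namespace RestrCalc

variable {n : ℂ} {U W : Type*} [AddCommGroup U] [Module ℂ U] [AddCommGroup W] [Module ℂ W]
  (c : RestrCalc n U W)

/-- The symmetry breaking operator in terms of powers of the tangential Laplacian and of the normal
derivative. -/
theorem sbo_eq_normal (l p : ℂ) (M : ℕ) (α : ℕ → ℂ) (dn iN : Module.End ℂ U)
    (hr : ∀ u, c.r (c.amb.lap u) = c.hyp.lap (c.r u) - c.r (dn (dn u)))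
    (hδ : ∀ u, c.r (c.amb.δ u) = c.hyp.δ (c.r u) - c.r (iN (dn u)))
    (hdn : ∀ u, c.amb.lap (dn u) = dn (c.amb.lap u))
    (hiN : ∀ u, c.amb.lap (iN u) = iN (c.amb.lap u)) (hdi : ∀ u, dn (iN u) = iN (dn u)) (u : U) :
    c.sbo l p (M + 1) α u =
      (l + p - 2 * (M + 1 : ℕ)) • ∑ j ∈ Finset.range (M + 1 + 1),
        ((-1) ^ (M + 1 - j) * ∑ i ∈ Finset.range (M + 1 + 1),
          α i * (i.choose (M + 1 - j) : ℂ)) •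
        (c.hyp.lap ^ j) (c.r ((dn ^ (2 * (M + 1 - j))) u))
      - ∑ j ∈ Finset.range (M + 1), ((-1) ^ (M - j) * (2 * ((M + 1 : ℕ) - j) *
          ∑ i ∈ Finset.range (M + 1 + 1), α i * (i.choose (M + 1 - j) : ℂ))) •
        (c.hyp.lap ^ j) (c.hyp.d (c.r (iN ((dn ^ (2 * (M - j) + 1)) u))))
      + ∑ j ∈ Finset.range (M + 1), ((-1) ^ (M - j) * (2 * (j + 1) *
          ∑ i ∈ Finset.range (M + 1 + 1), α i * (i.choose (M - j) : ℂ))) •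
        (c.hyp.lap ^ j) (c.hyp.d (c.hyp.δ (c.r ((dn ^ (2 * (M - j))) u)))) := by
  -- The binomial expansion is applied with `Y = -∂_n²`, once to the restriction and once to `κ`,
  -- the normal contribution by which `ι^* δ̄` differs from `δ ι^*`.
  let Y : Module.End ℂ U := -(dn * dn)
  let κ : U →ₗ[ℂ] W := c.r ∘ₗ iN ∘ₗ dn
  have hY : ∀ k u, (Y ^ k) u = ((-1 : ℂ) ^ k) • (dn ^ (2 * k)) u := fun k u => by
    rw [neg_pow, ← pow_two, ← pow_mul]
    rcases Nat.even_or_odd k with h | h <;> simp [h.neg_one_pow]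
  have hYc : ∀ u, c.amb.lap (Y u) = Y (c.amb.lap u) := fun u => by
    simp [Y, hdn]
  have hrY : ∀ u, c.r (c.amb.lap u) = c.hyp.lap (c.r u) + c.r (Y u) := fun u => by
    simp [Y, hr, sub_eq_add_neg]
  have hκY : ∀ u, κ (c.amb.lap u) = c.hyp.lap (κ u) + κ (Y u) := fun u => by
    simp only [κ, Y, LinearMap.comp_apply, ← hdn, ← hiN, hrY]
    simp [hdi]
  have hh : ∀ k i, c.y k i u = c.hyp.δ (c.x k i u) - (c.hyp.lap ^ k) (κ ((c.amb.lap ^ i) u)) :=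
    fun k i => by
      rw [y, h, LinearMap.comp_apply, LinearMap.comp_apply, hδ, map_sub,
        c.hyp.pow_comm c.hyp.lap_δ]
      rfl
  have hs : c.sbo l p (M + 1) α u = (l + p - 2 * (M + 1 : ℕ)) •
      ∑ i ∈ Finset.range (M + 1 + 1), α i • (c.hyp.lap ^ (M + 1 - i)) (c.r ((c.amb.lap ^ i) u))
      + (2 : ℂ) • (c.hyp.d (c.hyp.δ (∑ i ∈ Finset.range (M + 1),
          ((((M + 1 : ℕ) : ℂ) - i) * α i + (i + 1) * α (i + 1)) •
            (c.hyp.lap ^ (M - i)) (c.r ((c.amb.lap ^ i) u))))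
        - c.hyp.d (∑ i ∈ Finset.range (M + 1), ((i + 1) * α (i + 1)) •
            (c.hyp.lap ^ (M - i)) (κ ((c.amb.lap ^ i) u)))) := by
    simp only [sbo, hh, map_sum, map_smul, ← Finset.sum_sub_distrib, x,
      show ∀ i, M + 1 - i - 1 = M - i by omega, map_sub]
    congr 2
    refine Finset.sum_congr rfl fun i _ => ?_
    simp only [g, LinearMap.comp_apply]
    module
  rw [hs, c.sum_pow_expand c.r Y hrY hYc, c.sum_pow_expand c.r Y hrY hYc,
    c.sum_pow_expand κ Y hκY hYc, smul_sub, map_sum, map_sum, map_sum, ← add_sub_assoc,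
    sub_add_eq_add_sub]
  congr 1
  · congr 1
    · congr 1
      refine Finset.sum_congr rfl fun j _ => ?_
      rw [hY, map_smul, map_smul, smul_smul, mul_comm]
    · rw [Finset.smul_sum]
      refine Finset.sum_congr rfl fun j hj => ?_
      have hj' : j ≤ M := by simpa [Nat.lt_succ_iff] using hj
      rw [sum_sub_mul_choose _ _ _ hj', hY]
      simp only [map_smul, smul_smul]
      rw [c.hyp.pow_comm c.hyp.lap_d, c.hyp.pow_comm c.hyp.lap_δ]
      congr 1
      ring
  · rw [Finset.smul_sum]
    refine Finset.sum_congr rfl fun j hj => ?_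
    have hj' : j ≤ M := by simpa [Nat.lt_succ_iff] using hj
    rw [sum_mul_choose_shift, hY, map_smul, map_smul, map_smul, map_smul, smul_smul, smul_smul,
      c.hyp.pow_comm c.hyp.lap_d, show M + 1 - j = M - j + 1 by omega, pow_succ' dn,
      Nat.cast_sub hj']
    simp only [κ, LinearMap.comp_apply, Module.End.mul_apply]
    congr 1
    push_cast
    ring

end RestrCalc

end SymBreak

namespace SymBreak

/-! ### The restriction to the hyperplane -/

variable {m n p : ℕ}

@[simp] lemma incl_apply_castSucc (x : Euc m) (j : Fin m) : incl m x j.castSucc = x j := by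
  simp [incl]

@[simp] lemma incl_apply_last (x : Euc m) : incl m x (Fin.last m) = 0 := by
  simp [incl]

lemma inner_incl (x y : Euc m) : (inner ℝ (incl m x) (incl m y) : ℝ) = inner ℝ x y := by
  simp [PiLp.inner_apply, Fin.sum_univ_castSucc]

lemma incl_basisVec (j : Fin m) : incl m (basisVec j) = basisVec j.castSucc := by
  ext i
  refine Fin.lastCases ?_ (fun i => ?_) i
  · simp [(Fin.castSucc_lt_last j).ne]
  · simp [PiLp.single_apply]

/-- The restriction of alternating forms to the hyperplane. -/
def restrCLM : Alt (m + 1) p →L[ℝ] Alt m p :=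
  ContinuousAlternatingMap.compContinuousLinearMapCLM (incl m)

lemma contDiff_restr {η : Form (m + 1) p} (h : ContDiff ℝ ∞ η) : ContDiff ℝ ∞ (restr η) :=
  restrCLM.contDiff.comp
    (h.comp (incl m).contDiff)

lemma extD_restr {η : Form (m + 1) p} (h : Differentiable ℝ η) :
    extD (restr η) = restr (extD η) := by
  funext x
  have := extDeriv_pullback (h (incl m x)) ((incl m).contDiff (n := ∞)).contDiffAt (x := x)
    minSmoothness_two_le
  simp only [ContinuousLinearMap.fderiv] at this
  exact this

lemma fderiv_restr {η : Form (m + 1) p} (h : Differentiable ℝ η) (x v : Euc m) :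
    fderiv ℝ (restr η) x v =
      (fderiv ℝ η (incl m x) (incl m v)).compContinuousLinearMap (incl m) := by
  have h1 : HasFDerivAt (restr η)
      (restrCLM.comp
        ((fderiv ℝ η (incl m x)).comp (incl m))) x :=
    restrCLM.hasFDerivAt.comp x ((h _).hasFDerivAt.comp x (incl m).hasFDerivAt)
  rw [h1.fderiv]
  rfl

namespace SmoothForms

/-- The restriction to the hyperplane. -/
def restrict : SmoothForms (m + 1) →ₗ[ℂ] SmoothForms m :=
  mkHom (fun η p => restr (η.app p)) (fun η p => contDiff_restr (η.contDiff_app p))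
    (fun _ _ _ _ => rfl) (fun _ _ _ _ => rfl)

lemma restrict_app (η : SmoothForms (m + 1)) : (restrict η).app p = restr (η.app p) := rfl

lemma restrict_app_apply (η : SmoothForms (m + 1)) (x : Euc m) :
    (restrict η).app p x = (η.app p (incl m x)).compContinuousLinearMap (incl m) := rfl

lemma differentiable_app (η : SmoothForms n) (p : ℕ) : Differentiable ℝ (η.app p) := η.diffAt p

lemma restrict_d (η : SmoothForms (m + 1)) : restrict (d η) = d (restrict η) :=
  ext' fun p x => by
    rcases p with _ | p
    · rfl
    · exact (congrFun (extD_restr (η.differentiable_app p)) x).symm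

lemma restrict_insF {V : Euc (m + 1) → Euc (m + 1)} {hV : ContDiff ℝ ∞ V} {V' : Euc m → Euc m}
    {hV' : ContDiff ℝ ∞ V'} (h : ∀ x, V (incl m x) = incl m (V' x)) (η : SmoothForms (m + 1)) :
    restrict (insF V hV η) = insF V' hV' (restrict η) :=
  ext' fun p x => by
    rw [restrict_app_apply, insF_app, insF_app, restrict_app_apply, insCLM_apply, insCLM_apply,
      ContinuousAlternatingMap.curryLeft_compContinuousLinearMap, h]

lemma restrict_pd (v : Euc m) (η : SmoothForms (m + 1)) :
    restrict (pd (incl m v) η) = pd v (restrict η) :=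
  ext' fun p x => (fderiv_restr (η.differentiable_app p) x v).symm

lemma restrict_mulF {f : Euc (m + 1) → ℝ} {hf : ContDiff ℝ ∞ f} {f' : Euc m → ℝ}
    {hf' : ContDiff ℝ ∞ f'} (h : ∀ x, f (incl m x) = f' x) (η : SmoothForms (m + 1)) :
    restrict (mulF f hf η) = mulF f' hf' (restrict η) :=
  ext' fun p x => by
    rw [restrict_app_apply, mulF_app, mulF_app, restrict_app_apply, h]
    rfl

lemma restrict_deg (η : SmoothForms (m + 1)) : restrict (deg η) = deg (restrict η) := rfl

/-- As in `d_ext`, the exterior product is the commutator of `d` with a linear function, and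
restriction commutes with both. -/
lemma restrict_ext (v : Euc m) (η : SmoothForms (m + 1)) :
    restrict (ext (incl m v) η) = ext v (restrict η) := by
  have h := d_mulF _ (innerSL ℝ (incl m v)).contDiff _ (fun x => (innerSL ℝ (incl m v)).fderiv) η
  have h' := d_mulF _ (innerSL ℝ v).contDiff _ (fun x => (innerSL ℝ v).fderiv) (restrict η)
  have hf : ∀ x, innerSL ℝ (incl m v) (incl m x) = innerSL ℝ v x := inner_incl v
  rw [← restrict_mulF (hf := (innerSL ℝ (incl m v)).contDiff) hf, ← restrict_d, h, ← restrict_d,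
    map_add, restrict_mulF (hf' := (innerSL ℝ v).contDiff) hf] at h'
  exact add_right_cancel h'

lemma restrict_lie {V : Euc (m + 1) → Euc (m + 1)} {hV : ContDiff ℝ ∞ V} {V' : Euc m → Euc m}
    {hV' : ContDiff ℝ ∞ V'} (h : ∀ x, V (incl m x) = incl m (V' x)) (η : SmoothForms (m + 1)) :
    restrict (lie V hV η) = lie V' hV' (restrict η) := by
  rw [lie_apply, lie_apply, map_add, restrict_d, restrict_insF h, restrict_insF h, restrict_d]

/-- The normal vector. -/
abbrev normal (m : ℕ) : Euc (m + 1) := basisVec (Fin.last m)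

/-- In the sum over an orthonormal basis the tangential terms restrict to `δ`, and the normal one is
left over. -/
lemma restrict_δ (η : SmoothForms (m + 1)) : restrict (δ η) =
    δ (restrict η) - restrict (ins (normal m) (pd (normal m) η)) := by
  have h : ∀ (j : Fin m) (η : SmoothForms (m + 1)), restrict (ins (incl m (basisVec j)) η) =
      ins (basisVec j) (restrict η) := fun j η => restrict_insF (fun _ => rfl) η
  simp only [δ_eq_sum, Fin.sum_univ_castSucc, map_neg, map_add, map_sum, h, ← incl_basisVec,
    restrict_pd]
  abel

lemma δ_d_add_d_δ (η : SmoothForms n) :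
    δ (d η) + d (δ η) = -∑ j, pd (basisVec j) (pd (basisVec j) η) := by
  simp only [δ_eq_sum, map_neg, map_sum, d_ins, pd_d, Finset.sum_sub_distrib]
  abel

lemma restrict_laplacian (η : SmoothForms (m + 1)) : restrict (δ (d η) + d (δ η)) =
    δ (d (restrict η)) + d (δ (restrict η)) - restrict (pd (normal m) (pd (normal m) η)) := by
  simp only [δ_d_add_d_δ, Fin.sum_univ_castSucc, map_neg, map_add, map_sum, ← incl_basisVec,
    restrict_pd]
  abel

/-- The component of degree `p`, as a linear map. -/
def appHom (p : ℕ) : SmoothForms n →ₗ[ℂ] Form n p where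
  toFun η := η.app p
  map_add' _ _ := rfl
  map_smul' _ _ := rfl

lemma appHom_apply (η : SmoothForms n) : appHom p η = η.app p := rfl

/-- A smooth form of degree `p` as a form of mixed degree. -/
def single (η : Form n p) (hη : ContDiff ℝ ∞ η) : SmoothForms n :=
  ofFun (Pi.single p η) fun q => by
    rcases eq_or_ne q p with rfl | h
    · rwa [Pi.single_eq_same]
    · rw [Pi.single_eq_of_ne h]
      exact contDiff_const

@[simp] lemma single_app (η : Form n p) (hη : ContDiff ℝ ∞ η) : (single η hη).app p = η :=
  Pi.single_eq_same p η

lemma deg_single (η : Form n p) (hη : ContDiff ℝ ∞ η) :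
    deg (single η hη) = (p : ℂ) • single η hη :=
  ext' fun q x => by
    rcases eq_or_ne q p with rfl | h
    · rfl
    · have h0 : (single η hη).app q = 0 := Pi.single_eq_of_ne h η
      rw [deg_app, smul_app, h0]
      exact (smul_zero (A := Alt n q) (q : ℂ)).trans (smul_zero (A := Alt n q) (p : ℂ)).symm

lemma iterate_app {F : Form n p → Form n p} {f : Module.End ℂ (SmoothForms n)}
    (h : ∀ η, F (η.app p) = (f η).app p) (k : ℕ) (η : SmoothForms n) :
    F^[k] (η.app p) = ((f ^ k) η).app p := by
  induction k with
  | zero => rfl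
  | succ k ih => rw [Function.iterate_succ_apply', ih, h, pow_succ']; rfl

lemma extCodiff_app (η : SmoothForms n) : extCodiff p (η.app p) = (d (δ η)).app p := by
  cases p <;> rfl

lemma codiffExt_app (η : SmoothForms n) : codiffExt p (η.app p) = (δ (d η)).app p := rfl

lemma normalDeriv_app (η : SmoothForms (m + 1)) :
    normalDeriv (η.app p) = (pd (normal m) η).app p := rfl

lemma extRestrIns_app (η : SmoothForms (m + 1)) :
    extRestrIns p (η.app p) = (d (restrict (ins (normal m) η))).app p := by
  cases p <;> rfl

end SmoothForms

/-! ### Realization of the abstract operators on forms -/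

namespace ConfField
open SmoothForms

/-- The commutation relations for a conformal vector field that is tangential to the
hyperplane. -/
def restrCalc (F : ConfField (m + 1)) (F' : ConfField m)
    (hV : ∀ x, F.V (incl m x) = incl m (F'.V x)) (hσ : ∀ x, F.σ (incl m x) = F'.σ x)
    (hb : F.b = incl m F'.b) :
    RestrCalc ((m + 1 : ℕ) : ℂ) (SmoothForms (m + 1)) (SmoothForms m) where
  amb := F.confCalc _ rfl
  -- The dimension enters the relations only as a complex number, so `(m + 1) - 1` can serve as the
  -- dimension `m` of the hyperplane.
  hyp := F'.confCalc _ (by push_cast; ring)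
  r := restrict
  r_d := restrict_d
  r_e u := by
    change restrict (SmoothForms.ext F.b u) = _
    rw [hb, restrict_ext]
    rfl
  r_i u := restrict_insF (hV := contDiff_const) (hV' := contDiff_const) (fun _ => hb) u
  r_D u := by
    change restrict (pd F.b u) = _
    rw [hb, restrict_pd]
    rfl
  r_ρ l u := by
    change restrict (F.rep l u) = F'.rep l (restrict u)
    rw [rep_apply, rep_apply, map_sub, restrict_lie hV, restrict_mulF hσ, map_add, map_smul,
      restrict_deg]

variable (F : ConfField (m + 1)) (F' : ConfField m)
    (hV : ∀ x, F.V (incl m x) = incl m (F'.V x)) (hσ : ∀ x, F.σ (incl m x) = F'.σ x)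
    (hb : F.b = incl m F'.b)

theorem evenOp_app (N : ℕ) (lam : ℂ) (η : SmoothForms (m + 1)) :
    evenOp m N p lam (η.app p) =
      ((F.restrCalc F' hV hσ hb).geomOp lam p N (fun i => alphaCoeff (m + 1) N i lam) η).app p := by
  let c := F.restrCalc F' hV hσ hb
  have h1 := fun k η => iterate_app (p := p) (f := c.amb.dδ) (fun η => extCodiff_app η) k η
  have h2 := fun k η => iterate_app (p := p) (f := c.amb.δd) (fun η => codiffExt_app η) k η
  have h3 := fun k η => iterate_app (p := p) (f := c.hyp.dδ) (fun η => extCodiff_app η) k η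
  have h4 := fun k η => iterate_app (p := p) (f := c.hyp.δd) (fun η => codiffExt_app η) k η
  simp only [evenOp, h1, h2, ← restrict_app, h3, h4]
  simp only [RestrCalc.geomOp, ← appHom_apply, map_add, map_smul, map_sum]
  rfl

theorem evenOpGegenbauer_app (M : ℕ) (lam : ℂ) (η : SmoothForms (m + 1)) :
    evenOpGegenbauer m (M + 1) p lam (η.app p) = ((F.restrCalc F' hV hσ hb).sbo lam p (M + 1)
      (fun i => alphaCoeff (m + 1) (M + 1) i lam) η).app p := by
  let c := F.restrCalc F' hV hσ hb
  have h1 := fun k η => iterate_app (p := p) (f := c.hyp.lap) (F := laplacian p)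
    (fun η => by
      rw [laplacian, codiffExt_app, extCodiff_app]
      rfl) k η
  have h2 := fun k η => iterate_app (p := p) (f := pd (normal m)) normalDeriv_app k η
  have hlap : ∀ u, c.amb.lap u = -∑ j, pd (basisVec j) (pd (basisVec j) u) := δ_d_add_d_δ
  rw [RestrCalc.sbo_eq_normal _ _ _ _ _ (pd (normal m)) (ins (normal m)) restrict_laplacian
    restrict_δ (fun u => ?_) (fun u => ?_) (pd_ins _ _)]
  · simp only [evenOpGegenbauer, h2, ← restrict_app, extRestrIns_app, extCodiff_app, h1]
    simp only [← appHom_apply, map_add, map_sub, map_smul, map_sum]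
    rw [sub_eq_add_neg (G := Form m p), Finset.smul_sum, ← Finset.sum_neg_distrib]
    congr 1
    · congr 1
      · refine Finset.sum_congr rfl fun j hj => ?_
        have hj' : j ≤ M + 1 := by simpa [Nat.lt_succ_iff] using hj
        rw [sum_alphaCoeff_mul_choose _ _ _ _ hj', smul_smul, pCoeff, Nat.mul_sub]
        congr 1
        ring
      · refine Finset.sum_congr rfl fun j hj => ?_
        have hj' : j < M + 1 := by simpa using hj
        rw [sum_alphaCoeff_mul_choose _ _ _ _ hj'.le, qCoeff_eq _ _ _ _ hj',
          show 2 * (M + 1) - 2 * j - 1 = 2 * (M - j) + 1 by omega,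
          show M + 1 - j = M - j + 1 by omega]
        refine Eq.trans ?_ (neg_smul (M := Form m p) _ _)
        congr 1
        ring
    · refine Finset.sum_congr rfl fun j hj => ?_
      have hj' : j < M + 1 := by simpa using hj
      have h := sum_alphaCoeff_mul_choose (m + 1) (M + 1) (j + 1) lam hj'
      rw [Nat.add_sub_add_right] at h
      rw [h, rCoeff_eq _ _ _ _ hj',
        show 2 * (M + 1) - 2 * j - 2 = 2 * (M - j) by omega,
        show M + 1 - j - 1 = M - j by omega]
      rfl
  · change c.amb.lap _ = pd (normal m) (c.amb.lap _)
    simp only [hlap, map_neg, map_sum, pd_comm (normal m)]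
  · change c.amb.lap _ = ins (normal m) (c.amb.lap _)
    simp only [hlap, map_neg, map_sum, pd_ins]

end ConfField

end SymBreak

namespace SymBreak

/-! ### The conformal vector fields of the Lie algebra -/

variable {m n p : ℕ}

/-- The component with index `0`. -/
def projZero : (CIdx n → ℝ) →L[ℝ] ℝ := ContinuousLinearMap.proj (Sum.inl ())

/-- The components with indices `1, …, n`. -/
def projMid : (CIdx n → ℝ) →L[ℝ] Euc n :=
  (EuclideanSpace.equiv (Fin n) ℝ).symm.toContinuousLinearMap.comp
    (ContinuousLinearMap.pi fun i => ContinuousLinearMap.proj (Sum.inr (Sum.inl i)))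

@[simp] lemma projZero_apply (z : CIdx n → ℝ) : projZero z = z (Sum.inl ()) := rfl

@[simp] lemma projMid_apply (z : CIdx n → ℝ) (i : Fin n) :
    projMid z i = z (Sum.inr (Sum.inl i)) := rfl

/-- The action of a matrix on vectors. -/
def mulVecL : Matrix (CIdx n) (CIdx n) ℝ →ₗ[ℝ] (CIdx n → ℝ) →L[ℝ] (CIdx n → ℝ) :=
  LinearMap.toContinuousLinearMap.toLinearMap ∘ₗ Matrix.toLin'.toLinearMap

@[simp] lemma mulVecL_apply (M : Matrix (CIdx n) (CIdx n) ℝ) (z : CIdx n → ℝ) :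
    mulVecL M z = M *ᵥ z := rfl

/-- The differential of `lift`. -/
def liftDeriv (x : Euc n) : Euc n →L[ℝ] (CIdx n → ℝ) :=
  ContinuousLinearMap.pi fun a => match a with
    | .inl _ => 0
    | .inr (.inl i) => EuclideanSpace.proj i
    | .inr (.inr _) => -innerSL ℝ x

@[simp] lemma liftDeriv_zero (x v : Euc n) : liftDeriv x v (Sum.inl ()) = 0 := rfl
@[simp] lemma liftDeriv_mid (x v : Euc n) (i : Fin n) :
    liftDeriv x v (Sum.inr (Sum.inl i)) = v i := rfl
@[simp] lemma liftDeriv_last (x v : Euc n) :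
    liftDeriv x v (Sum.inr (Sum.inr ())) = -inner ℝ x v := rfl

lemma hasFDerivAt_lift (x : Euc n) : HasFDerivAt lift (liftDeriv x) x := by
  refine hasFDerivAt_pi'.2 fun a => ?_
  rcases a with a | i | a
  · exact hasFDerivAt_const 1 x
  · exact (EuclideanSpace.proj i : Euc n →L[ℝ] ℝ).hasFDerivAt
  · have h := ((hasStrictFDerivAt_norm_sq x).hasFDerivAt.const_mul (1 / 2)).neg
    convert! h using 1
    · funext y
      simp only [lift, Pi.neg_apply]
      ring
    · ext v
      simp [liftDeriv]

lemma contDiff_lift : ContDiff ℝ ∞ (lift (n := n)) := by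
  refine contDiff_pi.2 fun a => ?_
  rcases a with a | i | a
  · exact contDiff_const
  · exact (EuclideanSpace.proj i : Euc n →L[ℝ] ℝ).contDiff
  · exact ((contDiff_norm_sq ℝ).div_const 2).neg

lemma projMid_lift (x : Euc n) : projMid (lift x) = x := rfl
lemma projZero_lift (x : Euc n) : projZero (lift x) = 1 := rfl

lemma dotProduct_gram (u w : CIdx n → ℝ) : u ⬝ᵥ (gram n *ᵥ w) =
    projZero u * w (Sum.inr (Sum.inr ())) + u (Sum.inr (Sum.inr ())) * projZero w
      + inner ℝ (projMid u) (projMid w) := by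
  simp [dotProduct, Matrix.mulVec, gram, PiLp.inner_apply, Fintype.sum_sum_type, mul_comm]
  ring

lemma soConf_skew (X : soConf n) (u w : CIdx n → ℝ) :
    (X.1 *ᵥ u) ⬝ᵥ (gram n *ᵥ w) + u ⬝ᵥ (gram n *ᵥ (X.1 *ᵥ w)) = 0 := by
  have hX : X.1ᵀ * gram n = gram n * -X.1 := (mem_skewAdjointMatricesSubmodule _ _).1 X.2
  rw [← Matrix.vecMul_transpose, ← Matrix.dotProduct_mulVec, Matrix.mulVec_mulVec, hX,
    Matrix.mul_neg, Matrix.neg_mulVec, dotProduct_neg, Matrix.mulVec_mulVec, neg_add_cancel]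

/-- The corresponding basis vector is isotropic. Consequently the quadratic entry of `lift x` does
not enter `σ`, which is therefore affine with constant gradient. -/
lemma soConf_zero_last (X : soConf n) : X.1 (Sum.inl ()) (Sum.inr (Sum.inr ())) = 0 := by
  have h := soConf_skew X (Pi.single (Sum.inr (Sum.inr ())) 1) (Pi.single (Sum.inr (Sum.inr ())) 1)
  have h0 : projMid (n := n) (Pi.single (Sum.inr (Sum.inr ())) 1) = 0 := by
    ext i; simp
  rw [dotProduct_gram, dotProduct_gram, h0] at h
  simp at h
  linarith

/-- The vector field of the flow of `exp (-tX)`. -/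
def confV (X : soConf n) (x : Euc n) : Euc n :=
  -projMid (X.1 *ᵥ lift x) + projZero (X.1 *ᵥ lift x) • x

lemma hasFDerivAt_confV (X : soConf n) (x : Euc n) : HasFDerivAt (confV X)
    (-projMid.comp ((mulVecL X.1).comp (liftDeriv x))
      + (projZero (X.1 *ᵥ lift x) • ContinuousLinearMap.id ℝ _
      + (projZero.comp ((mulVecL X.1).comp (liftDeriv x))).smulRight x)) x := by
  have h := (mulVecL X.1).hasFDerivAt.comp x (hasFDerivAt_lift x)
  exact (projMid.hasFDerivAt.comp x h).neg.add
    ((projZero.hasFDerivAt.comp x h).smul (hasFDerivAt_id x))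

lemma fderiv_confV (X : soConf n) (x v : Euc n) : fderiv ℝ (confV X) x v =
    -projMid (X.1 *ᵥ liftDeriv x v) + (projZero (X.1 *ᵥ lift x) • v
      + projZero (X.1 *ᵥ liftDeriv x v) • x) := by
  rw [(hasFDerivAt_confV X x).fderiv]
  rfl

/-- The conformal vector field of an element of the Lie algebra. -/
def confField (X : soConf n) : ConfField n where
  V := confV X
  σ x := projZero (X.1 *ᵥ lift x)
  b := WithLp.toLp 2 fun j => X.1 (Sum.inl ()) (Sum.inr (Sum.inl j))
  hV := by
    have h := (mulVecL X.1).contDiff.comp contDiff_lift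
    exact (projMid.contDiff.comp h).neg.add ((projZero.contDiff.comp h).smul contDiff_id)
  hσ := projZero.contDiff.comp ((mulVecL X.1).contDiff.comp contDiff_lift)
  hb x := by
    have h := (mulVecL X.1).hasFDerivAt.comp x (hasFDerivAt_lift x)
    refine (projZero.hasFDerivAt.comp x h).fderiv.trans ?_
    ext v
    simp [Matrix.mulVec, dotProduct, Fintype.sum_sum_type, soConf_zero_last, PiLp.inner_apply,
      mul_comm]
  -- The vectors `liftDeriv x u` and `liftDeriv x v` pair to the inner product of `u` and `v`.
  -- Skewness of `X` on them is exactly the conformal Killing equation.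
  conf x u v := by
    have h := soConf_skew X (liftDeriv x u) (liftDeriv x v)
    have h1 : ∀ w, projMid (liftDeriv x w) = w := fun _ => rfl
    have h2 : ∀ w, projZero (liftDeriv x w) = 0 := fun _ => rfl
    rw [dotProduct_gram, dotProduct_gram, h1, h1, h2, h2, liftDeriv_last, liftDeriv_last] at h
    rw [fderiv_confV, fderiv_confV]
    simp only [inner_add_left, inner_add_right, inner_neg_left, inner_neg_right, inner_smul_left,
      inner_smul_right, conj_trivial, real_inner_comm x u] at h ⊢
    linarith [real_inner_comm x u]

lemma projZero_blockIncl (X : soConf m) (x : Euc m) :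
    projZero ((soIncl X).1 *ᵥ lift (incl m x)) = projZero (X.1 *ᵥ lift x) := by
  have hn : ‖incl m x‖ = ‖x‖ := by
    rw [norm_eq_sqrt_real_inner, inner_incl, ← norm_eq_sqrt_real_inner]
  simp [soIncl, blockIncl, idxPart, Matrix.mulVec, dotProduct, Fintype.sum_sum_type, lift,
    Fin.sum_univ_castSucc, hn]

lemma projMid_blockIncl (X : soConf m) (x : Euc m) :
    projMid ((soIncl X).1 *ᵥ lift (incl m x)) = incl m (projMid (X.1 *ᵥ lift x)) := by
  have hn : ‖incl m x‖ = ‖x‖ := by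
    rw [norm_eq_sqrt_real_inner, inner_incl, ← norm_eq_sqrt_real_inner]
  ext i
  refine Fin.lastCases ?_ (fun i => ?_) i <;>
  simp [soIncl, blockIncl, idxPart, Matrix.mulVec, dotProduct, Fintype.sum_sum_type, lift,
    Fin.sum_univ_castSucc, hn]

lemma confV_soIncl (X : soConf m) (x : Euc m) :
    (confField (soIncl X)).V (incl m x) = incl m ((confField X).V x) := by
  simp only [confField, confV, projZero_blockIncl, projMid_blockIncl, map_add, map_neg, map_smul]

lemma confField_b_soIncl (X : soConf m) : (confField (soIncl X)).b = incl m (confField X).b := by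
  ext i
  refine Fin.lastCases ?_ (fun i => ?_) i <;> simp [confField, soIncl, blockIncl, idxPart]

end SymBreak

namespace SymBreak

/-! ### The infinitesimal representation -/

variable {m n p : ℕ}

lemma gram_mul_gram : gram n * gram n = 1 := by
  ext a b
  rcases a with a | a | a <;> rcases b with b | b | b <;>
    simp [Matrix.mul_apply, Fintype.sum_sum_type, gram, Matrix.one_apply]

lemma exp_preserves_gram (Y : soConf n) (u w : CIdx n → ℝ) :
    (NormedSpace.exp Y.1 *ᵥ u) ⬝ᵥ (gram n *ᵥ (NormedSpace.exp Y.1 *ᵥ w)) = u ⬝ᵥ (gram n *ᵥ w) := by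
  have hY : Y.1ᵀ * gram n = gram n * -Y.1 := (mem_skewAdjointMatricesSubmodule _ _).1 Y.2
  have hi : (gram n)⁻¹ = gram n := Matrix.inv_eq_right_inv gram_mul_gram
  have hu : IsUnit (gram n) := IsUnit.of_mul_eq_one _ gram_mul_gram
  have hT : Y.1ᵀ = gram n * -Y.1 * (gram n)⁻¹ := by
    rw [hi, ← hY, Matrix.mul_assoc, gram_mul_gram, Matrix.mul_one]
  have h : (NormedSpace.exp Y.1)ᵀ * (gram n * NormedSpace.exp Y.1) = gram n := by
    have hdet := (Matrix.isUnit_iff_isUnit_det _).1 (Matrix.isUnit_exp Y.1)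
    rw [← Matrix.exp_transpose, hT, Matrix.exp_conj _ _ hu, Matrix.exp_neg, hi, Matrix.mul_assoc,
      ← Matrix.mul_assoc (gram n) (gram n), gram_mul_gram, Matrix.one_mul, Matrix.mul_assoc,
      Matrix.nonsing_inv_mul _ hdet, Matrix.mul_one]
  rw [← Matrix.vecMul_transpose, ← Matrix.dotProduct_mulVec, Matrix.mulVec_mulVec,
    Matrix.mulVec_mulVec, Matrix.mul_assoc, h]

lemma act_eq (M : Matrix (CIdx n) (CIdx n) ℝ) (x : Euc n) :
    act M x = (projZero (mulVecL M (lift x)))⁻¹ • projMid (mulVecL M (lift x)) := by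
  ext i
  simp [act, div_eq_inv_mul]

/-- The differential of the conformal action of a matrix. -/
def actDeriv (L : (CIdx n → ℝ) →L[ℝ] (CIdx n → ℝ)) (x : Euc n) : Euc n →L[ℝ] Euc n :=
  (projZero (L (lift x)))⁻¹ • projMid.comp (L.comp (liftDeriv x)) +
    (-((projZero (L (lift x))) ^ 2)⁻¹ • projZero.comp (L.comp (liftDeriv x))).smulRight
      (projMid (L (lift x)))

lemma hasFDerivAt_act (M : Matrix (CIdx n) (CIdx n) ℝ) (x : Euc n)
    (h : projZero (mulVecL M (lift x)) ≠ 0) : HasFDerivAt (act M) (actDeriv (mulVecL M) x) x := by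
  have h0 := (mulVecL M).hasFDerivAt.comp x (hasFDerivAt_lift x)
  have h1 := ((hasDerivAt_inv h).comp_hasFDerivAt x (projZero.hasFDerivAt.comp x h0)).smul
    (projMid.hasFDerivAt.comp x h0)
  exact h1.congr_of_eventuallyEq (Filter.Eventually.of_forall fun y => act_eq M y)

/-- With `a0` and `c0` the components at index `0` of `M (lift x)` and `M (liftDeriv x v)`, the
vector `M (a0 • liftDeriv x v - c0 • lift x)` has component `0` there. Its quadratic form is the
squared norm of its middle part, `a0 ^ 2` times the differential applied to `v`. Since `lift x` is
isotropic and orthogonal to `liftDeriv x v`, invariance gives `a0 ^ 2 * ‖v‖ ^ 2`. -/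
lemma norm_actDeriv_apply (M : Matrix (CIdx n) (CIdx n) ℝ) (x v : Euc n)
    (hM : ∀ u w, (M *ᵥ u) ⬝ᵥ (gram n *ᵥ (M *ᵥ w)) = u ⬝ᵥ (gram n *ᵥ w))
    (h : projZero (mulVecL M (lift x)) ≠ 0) :
    ‖actDeriv (mulVecL M) x v‖ = |projZero (mulVecL M (lift x))|⁻¹ * ‖v‖ := by
  have h1 := hM (liftDeriv x v) (liftDeriv x v)
  have h2 := hM (liftDeriv x v) (lift x)
  have h3 := hM (lift x) (lift x)
  have hl : lift x (Sum.inr (Sum.inr ())) = -(‖x‖ ^ 2 / 2) := rfl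
  have hd : ∀ w, projMid (liftDeriv x w) = w := fun _ => rfl
  have hd0 : ∀ w, projZero (liftDeriv x w) = 0 := fun _ => rfl
  simp only [dotProduct_gram, projMid_lift, projZero_lift, hd, hd0, liftDeriv_last, hl,
    real_inner_self_eq_norm_sq, real_inner_comm x v] at h1 h2 h3
  refine (sq_eq_sq₀ (norm_nonneg _) (by positivity)).1 ?_
  have hA : actDeriv (mulVecL M) x v = (projZero (M *ᵥ lift x))⁻¹ • projMid (M *ᵥ liftDeriv x v)
      + (-((projZero (M *ᵥ lift x)) ^ 2)⁻¹ * projZero (M *ᵥ liftDeriv x v)) •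
        projMid (M *ᵥ lift x) := rfl
  rw [hA, mul_pow, inv_pow, sq_abs, mulVecL_apply, norm_add_sq_real, norm_smul, norm_smul, mul_pow,
    mul_pow, inner_smul_left, inner_smul_right, Real.norm_eq_abs, Real.norm_eq_abs, sq_abs, sq_abs]
  rw [mulVecL_apply] at h
  generalize projZero (M *ᵥ lift x) = a0 at *
  generalize projZero (M *ᵥ liftDeriv x v) = c0 at *
  simp only [conj_trivial]
  field_simp
  linear_combination a0 ^ 2 * h1 - 2 * a0 * c0 * h2 + c0 ^ 2 * h3

/-- A homothety has its ratio as operator norm, except in dimension zero, where the norm is zero.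
This is why the hyperplane must have positive dimension. -/
lemma confExp_act [NeZero n] (M : Matrix (CIdx n) (CIdx n) ℝ) (x : Euc n)
    (hM : ∀ u w, (M *ᵥ u) ⬝ᵥ (gram n *ᵥ (M *ᵥ w)) = u ⬝ᵥ (gram n *ᵥ w))
    (h : projZero (mulVecL M (lift x)) ≠ 0) :
    confExp (act M) x = -Real.log (projZero (mulVecL M (lift x))) := by
  rw [confExp, (hasFDerivAt_act M x h).fderiv,
    ContinuousLinearMap.homothety_norm _ fun v => norm_actDeriv_apply M x v hM h, Real.log_inv,
    Real.log_abs]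

open scoped Matrix.Norms.Operator in
lemma hasDerivAt_mulVecL_exp (X : Matrix (CIdx n) (CIdx n) ℝ) :
    HasDerivAt (fun t : ℝ => mulVecL (NormedSpace.exp (t • X))⁻¹) (-mulVecL X) 0 := by
  have h := hasDerivAt_exp_smul_const (𝕂 := ℝ) (-X) 0
  have h1 := (LinearMap.toContinuousLinearMap (mulVecL (n := n))).hasFDerivAt.comp_hasDerivAt 0 h
  simp only [zero_smul, NormedSpace.exp_zero, one_mul, LinearMap.coe_toContinuousLinearMap'] at h1
  refine (h1.congr_deriv (map_neg mulVecL X)).congr_of_eventuallyEq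
    (Filter.Eventually.of_forall fun t => ?_)
  change mulVecL _ = mulVecL (NormedSpace.exp (t • -X))
  rw [smul_neg, Matrix.exp_neg]

lemma mulVecL_exp_zero (X : Matrix (CIdx n) (CIdx n) ℝ) :
    mulVecL (NormedSpace.exp ((0 : ℝ) • X))⁻¹ = ContinuousLinearMap.id ℝ _ := by
  ext z : 1
  simp [NormedSpace.exp_zero]

lemma inv_exp_preserves_gram (X : soConf n) (t : ℝ) (u w : CIdx n → ℝ) :
    ((NormedSpace.exp (t • X.1))⁻¹ *ᵥ u) ⬝ᵥ (gram n *ᵥ ((NormedSpace.exp (t • X.1))⁻¹ *ᵥ w)) =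
      u ⬝ᵥ (gram n *ᵥ w) := by
  rw [← Matrix.exp_neg]
  exact exp_preserves_gram (-(t • X)) u w

lemma actDeriv_id (x : Euc n) : actDeriv (ContinuousLinearMap.id ℝ _) x = .id ℝ _ := by
  ext v : 1
  change (projZero (lift x))⁻¹ • projMid (liftDeriv x v) +
    (-((projZero (lift x)) ^ 2)⁻¹ * projZero (liftDeriv x v)) • projMid (lift x) = v
  rw [projZero_lift, show projZero (liftDeriv x v) = 0 from rfl]
  simp only [inv_one, one_smul, mul_zero, zero_smul, add_zero]
  rfl

variable {L : ℝ → (CIdx n → ℝ) →L[ℝ] (CIdx n → ℝ)} {L' : (CIdx n → ℝ) →L[ℝ] (CIdx n → ℝ)}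

lemma hasDerivAt_actDeriv (hL : HasDerivAt L L' 0) (h0 : L 0 = .id ℝ _) (x : Euc n) :
    HasDerivAt (fun t => actDeriv (L t) x) (projMid.comp (L'.comp (liftDeriv x))
      + (-projZero (L' (lift x)) • ContinuousLinearMap.id ℝ _
        + (-projZero.comp (L'.comp (liftDeriv x))).smulRight x)) 0 := by
  have hz : HasDerivAt (fun t => L t (lift x)) (L' (lift x)) 0 := by
    simpa using hL.clm_apply (hasDerivAt_const 0 (lift x))
  have hD : HasDerivAt (fun t => (L t).comp (liftDeriv x)) (L'.comp (liftDeriv x)) 0 := by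
    simpa using hL.clm_comp (hasDerivAt_const 0 (liftDeriv x))
  have hf : HasDerivAt (fun t => projZero (L t (lift x))) (projZero (L' (lift x))) 0 :=
    projZero.hasFDerivAt.comp_hasDerivAt 0 hz
  have hg : HasDerivAt (fun t => projMid (L t (lift x))) (projMid (L' (lift x))) 0 :=
    projMid.hasFDerivAt.comp_hasDerivAt 0 hz
  have hf0 : projZero (L 0 (lift x)) = 1 := by rw [h0]; rfl
  have h1 : HasDerivAt (fun t => projMid.comp ((L t).comp (liftDeriv x)))
      (projMid.comp (L'.comp (liftDeriv x))) 0 := by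
    simpa using (hasDerivAt_const 0 (projMid (n := n))).clm_comp hD
  have h2 : HasDerivAt (fun t => projZero.comp ((L t).comp (liftDeriv x)))
      (projZero.comp (L'.comp (liftDeriv x))) 0 := by
    simpa using (hasDerivAt_const 0 (projZero (n := n))).clm_comp hD
  have h3 := (hf.fun_inv (by rw [hf0]; exact one_ne_zero)).fun_smul h1
  have h4 := ((hf.fun_pow 2).fun_inv (by rw [hf0]; norm_num)).fun_neg.fun_smul h2
  have h5 := (ContinuousLinearMap.smulRightL ℝ (Euc n) (Euc n)).hasDerivAt_of_bilinear
    (fun _ => h4) (fun _ => hg)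
  refine (h3.add h5).congr_deriv ?_
  ext v : 1
  have hd : projZero (liftDeriv x v) = 0 := rfl
  have hm : projMid (liftDeriv x v) = v := rfl
  have hl : lift x (Sum.inl ()) = 1 := rfl
  simp [h0, hd, hm, hl, projMid_lift]
  abel

/-- This is the product rule at the identity for three factors: moving the base point gives the
directional derivative along `V`, the differential of the action gives the derivation by `DV`, and
the exponential factor gives `μ σ`. -/
lemma hasDerivAt_confRep [NeZero n] (X : soConf n) (μ : ℂ) (η : Form n p)
    (hη : Differentiable ℝ η) (x : Euc n) : HasDerivAt (fun t : ℝ => repCurve μ X η t x)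
      (fderiv ℝ η x (confV X x) + derivCLM (fderiv ℝ (confV X) x) (η x)
        + (μ * ((confField X).σ x : ℂ)) • η x) 0 := by
  let L : ℝ → (CIdx n → ℝ) →L[ℝ] (CIdx n → ℝ) := fun t => mulVecL (NormedSpace.exp (t • X.1))⁻¹
  have hL : HasDerivAt L (-mulVecL X.1) 0 := hasDerivAt_mulVecL_exp X.1
  have h0 : L 0 = .id ℝ _ := mulVecL_exp_zero X.1
  have hz : HasDerivAt (fun t => L t (lift x)) (-(X.1 *ᵥ lift x)) 0 := by
    simpa using hL.clm_apply (hasDerivAt_const 0 (lift x))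
  have hf : HasDerivAt (fun t => projZero (L t (lift x))) (-projZero (X.1 *ᵥ lift x)) 0 :=
    projZero.hasFDerivAt.comp_hasDerivAt 0 hz
  have hg : HasDerivAt (fun t => projMid (L t (lift x))) (-projMid (X.1 *ᵥ lift x)) 0 :=
    (projMid.hasFDerivAt.comp_hasDerivAt 0 hz).congr_deriv (map_neg _ _)
  have hf0 : projZero (L 0 (lift x)) = 1 := by rw [h0]; rfl
  have hg0 : projMid (L 0 (lift x)) = x := by rw [h0]; rfl
  have hγ : HasDerivAt (fun t => (projZero (L t (lift x)))⁻¹ • projMid (L t (lift x)))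
      (confV X x) 0 := by
    refine ((hf.fun_inv (by rw [hf0]; exact one_ne_zero)).fun_smul hg).congr_deriv ?_
    simp only [hf0, hg0, confV]
    simp
  have hA := (hasDerivAt_actDeriv hL h0 x).congr_deriv
    (show _ = fderiv ℝ (confV X) x by
      ext v : 1
      rw [fderiv_confV]
      simp)
  have hη' : HasFDerivAt η (fderiv ℝ η x)
      ((projZero (L 0 (lift x)))⁻¹ • projMid (L 0 (lift x))) := by
    rw [hf0, hg0, inv_one, one_smul]
    exact (hη x).hasFDerivAt
  have h1 := (hη'.comp_hasDerivAt 0 hγ).hasFDerivAt.continuousAlternatingMapCompContinuousLinearMap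
    hA.hasFDerivAt |>.hasDerivAt
  have h2 := ((hf.log (by rw [hf0]; exact one_ne_zero)).fun_neg.ofReal_comp.const_mul μ).cexp
  have h3 := h2.fun_smul h1
  have hev : ∀ᶠ t in nhds (0 : ℝ), projZero (L t (lift x)) ≠ 0 :=
    hf.continuousAt.eventually_ne (by rw [hf0]; exact one_ne_zero)
  -- The explicit formulas for the action hold only where the denominator is nonzero, hence for
  -- small `t`, which suffices for a derivative at `0`.
  refine (h3.congr_of_eventuallyEq (hev.mono fun t ht => ?_)).congr_deriv ?_
  · rw [repCurve, confRep, confExp_act _ _ (inv_exp_preserves_gram X t) ht, act_eq,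
      (hasFDerivAt_act _ x ht).fderiv]
    rfl
  · have hA0 : actDeriv (L 0) x = .id ℝ _ := by rw [h0, actDeriv_id]
    have hη0 : (η ∘ fun t => (projZero (L t (lift x)))⁻¹ • projMid (L t (lift x))) 0 = η x := by
      rw [Function.comp_apply, hf0, hg0, inv_one, one_smul]
    have hid : ∀ a : Alt n p, a.compContinuousLinearMap (.id ℝ _) = a := fun a => by
      ext v
      rfl
    rw [hA0, hη0, hf0, Real.log_one, neg_zero, Complex.ofReal_zero, mul_zero, Complex.exp_zero,
      one_smul, one_mul, div_one, neg_neg, hid, add_apply, ContinuousLinearMap.comp_apply,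
      ContinuousLinearMap.comp_apply, ContinuousLinearMap.toSpanSingleton_apply_one,
      ContinuousLinearMap.toSpanSingleton_apply_one]
    congr 2

end SymBreak

/-! ### Identification of the representation and conclusion -/

namespace SymBreak

open SmoothForms

variable {m n p : ℕ}

lemma dRep_app [NeZero n] (X : soConf n) (l : ℂ) (η : SmoothForms n) :
    dRep (-l - p) X (η.app p) = ((confField X).rep l η).app p := by
  funext x
  rw [dRep, (hasDerivAt_confRep X _ _ (η.differentiable_app p) x).deriv, ConfField.rep_apply,
    sub_app, lie_app, mulF_app, add_app, smul_app, deg_app]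
  have h : ((-l - p) * ((confField X).σ x : ℂ)) • η.app p x =
      -((confField X).σ x • (l • η.app p x + (p : ℂ) • η.app p x)) := by
    ext v
    simp
    ring
  rw [h, ← sub_eq_add_neg]
  rfl

lemma hasDRep_app [NeZero n] (X : soConf n) (l : ℂ) (η : SmoothForms n) :
    HasDRep (-l - p) X (η.app p) :=
  ⟨fun x => (hasDerivAt_confRep X _ _ (η.differentiable_app p) x).differentiableAt, by
    rw [dRep_app]
    exact contDiff_app _ p⟩

/-- The commutation relations for an element of the Lie algebra of the hyperplane. -/
abbrev soRestrCalc (X : soConf m) :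
    RestrCalc ((m + 1 : ℕ) : ℂ) (SmoothForms (m + 1)) (SmoothForms m) :=
  (confField (soIncl X)).restrCalc (confField X) (confV_soIncl X) (projZero_blockIncl X)
    (confField_b_soIncl X)

lemma evenOp_eq (X : soConf m) (M : ℕ) (lam : ℂ) (η : SmoothForms (m + 1)) :
    evenOp m (M + 1) p lam (η.app p) = ((soRestrCalc X).sbo lam p (M + 1)
      (fun i => alphaCoeff (m + 1) (M + 1) i lam) η).app p := by
  rw [ConfField.evenOp_app _ _ (confV_soIncl X) (projZero_blockIncl X) (confField_b_soIncl X),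
    RestrCalc.geomOp_eq_sbo]

end SymBreak

end

theorem theorem1p1 (m N p : ℕ) (hm : 1 ≤ m) (hN : 1 ≤ N) (hp : p ≤ m) (lam : ℂ) :
    (∀ η : SymBreak.Form (m + 1) p, ContDiff ℝ ∞ η →
      ContDiff ℝ ∞ (SymBreak.evenOp m N p lam η)) ∧
    (∀ η : SymBreak.Form (m + 1) p, ContDiff ℝ ∞ η →
      SymBreak.evenOp m N p lam η = SymBreak.evenOpGegenbauer m N p lam η) ∧
    (∀ X : SymBreak.soConf m, ∀ η : SymBreak.Form (m + 1) p, ContDiff ℝ ∞ η →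
      SymBreak.HasDRep (-lam - p) (SymBreak.soIncl X) η ∧
      SymBreak.HasDRep (-lam + 2 * N - p) X (SymBreak.evenOp m N p lam η) ∧
      SymBreak.dRep (-lam + 2 * N - p) X (SymBreak.evenOp m N p lam η) =
        SymBreak.evenOp m N p lam (SymBreak.dRep (-lam - p) (SymBreak.soIncl X) η)) := by
  open SymBreak SmoothForms in
  obtain ⟨M, rfl⟩ : ∃ M, N = M + 1 := ⟨N - 1, by omega⟩
  have : NeZero m := ⟨by omega⟩
  refine ⟨fun η hη => ?_, fun η hη => ?_, fun X η hη => ?_⟩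
  -- The operator does not involve a Lie algebra element, so the zero element supplies the calculus
  -- here and for the second claim.
  · rw [← single_app η hη, evenOp_eq 0]
    exact contDiff_app _ p
  · rw [← single_app η hη, evenOp_eq 0]
    exact (ConfField.evenOpGegenbauer_app _ _ (confV_soIncl 0) (projZero_blockIncl 0)
      (confField_b_soIncl 0) M lam _).symm
  -- The target parameter is that of `ρ` with weight `lam - 2N`, the weight produced by `sbo_ρ`.
  -- Placing the form in a single degree makes it an eigenvector of the degree operator.
  · rw [← single_app η hη, show -lam + 2 * ((M + 1 : ℕ) : ℂ) - p
      = -(lam - 2 * ((M + 1 : ℕ) : ℂ)) - p by ring, evenOp_eq X]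
    refine ⟨hasDRep_app _ _ _, hasDRep_app _ _ _, ?_⟩
    rw [dRep_app, dRep_app, evenOp_eq X]
    refine congrArg (fun θ : SmoothForms m => θ.app p) (Eq.symm ?_)
    refine (soRestrCalc X).sbo_ρ lam p M _ _ restrict_deg (deg_single η hη) fun i hi => ?_
    exact alphaCoeff_succ _ _ _ _ hi
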